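/- Let $\mathbb D\in\{\mathbb R,\mathbb T\}$ with $\mathbb T=\mathbb R/2\pi\mathbb Z$, and let $V,f:\mathbb D^d\to\mathbb R$ be smooth, with $\mathrm e^{-V}$ Lebesgue integrable and $f$ integrable with respect to $\mu=\mathrm e^{-V}/Z$, $Z=\int_{\mathbb D^d}\mathrm e^{-V}$. Put $I=\int f\,\mathrm d\mu$. For $U:\mathbb D^d\to\mathbb R$ put $Z[U]=\int_{\mathbb D^d}\mathrm e^{-V-U}$, $\mu_U=\mathrm e^{-V-U}/Z[U]$, $\mathcal L_U=\Delta-\nabla(V+U)\cdot\nabla$, $L^2_0(\mu_U)=\{\varphi\in L^2(\mu_U):\int\varphi\,\mathrm d\mu_U=0\}$, and let $H^1(\mu_U)$ be the set of $\varphi\in L^2(\mu_U)$ with weak gradient in $L^2(\mu_U)^d$. A weak solution of $-\mathcal L_U u=h$ is a function $u\in H^1(\mu_U)\cap L^2_0(\mu_U)$ such that $\int\nabla u\cdot\nabla\varphi\,\mathrm d\mu_U=\int h\,\varphi\,\mathrm d\mu_U$ for all $\varphi\in H^1(\mu_U)\cap L^2_0(\mu_U)$. Let $\mathfrak U_0$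 be the set of smooth $U:\mathbb D^d\to\mathbb R$ such that $\mathrm e^{-V-U}$ is Lebesgue integrable, $(f-I)\mathrm e^U\in L^2(\mu_U)$, and $\mu_U$ satisfies a Poincaré inequality: for some $R>0$, $\|\varphi\|_{L^2(\mu_U)}^2\le \frac1R\|\nabla\varphi\|_{L^2(\mu_U)}^2$ for all $\varphi\in H^1(\mu_U)\cap L^2_0(\mu_U)$. Define $$\sigma^2_f[U]=\frac{2Z[U]^2}{Z^2}\int_{\mathbb D^d}|\nabla\phi_U|^2\,\mathrm d\mu_U,$$ where $\phi_U$ is the weak solution of $-\mathcal L_U\phi_U=(f-I)\mathrm e^U$ (with $\sigma_f^2[U]=0$ by convention if there is none). For a functional $E$, let $\mathrm dE[U]\cdot\delta U=\lim_{\varepsilon\to0}\varepsilon^{-1}(E[U+\varepsilon\,\delta U]-E[U])$. **Proposition.** Let $U\in\mathfrak U_0$. The weak solution $\phi_U$ exists and is unique. For $\delta X\in C_c^\infty(\mathbb D^d)$ put $\delta X_0=\delta X-\int\delta X\,\mathrm d\mu_U$; there is a unique weak solution $\psi_{U,\delta X_0}$ of $$-\mathcal L_U\psi_{U,\delta X_0}=(f-I)\mathrm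 e^U\delta X_0-\nabla(\delta X_0)\cdot\nabla\phi_U .$$ For all $\delta U,\delta W\in C_c^\infty(\mathbb D^d)$, the derivative $\mathrm d\sigma_f^2[U+\varepsilon\,\delta W]\cdot\delta U$ exists for every $\varepsilon\in\mathbb R$, the second variation exists, and $$\begin{aligned}\tfrac12\,\mathrm d\bigl(\mathrm d\sigma^2_f[U]\cdot\delta U\bigr)\cdot\delta W={}&\frac{Z[U]}{Z^2}\int_{\mathbb D^d}\delta U_0\,\delta W_0\Bigl(|\nabla\phi_U|^2+\int_{\mathbb D^d}|\nabla\phi_U|^2\,\mathrm d\mu_U\Bigr)\mathrm e^{-V-U}\\&-\frac{2Z[U]}{Z^2}\int_{\mathbb D^d}\bigl(\nabla\psi_{U,\delta U_0}-\delta U_0\nabla\phi_U\bigr)\cdot\bigl(\nabla\psi_{U,\delta W_0}-\delta W_0\nabla\phi_U\bigr)\mathrm e^{-V-U}.\end{aligned}$$ If $d=1$ and $\mathbb D=\mathbb R$, the second term on the right-hand side is zero, and $\sigma^2_f$ is a convex functional: for all $U_0,U_1\in\mathfrak U_0$ and $t\in[0,1]$, $$\sigma_f^2[(1-t)U_0+tU_1]\le(1-t)\,\sigma_f^2[U_0]+t\,\sigma_f^2[U_1].$$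 -/

import Mathlib

open MeasureTheory
open scoped ContDiff

noncomputable section

/-- The Euclidean space `ℝ^d`. -/
abbrev Space (d : ℕ) : Type := EuclideanSpace ℝ (Fin d)

/-- The two possible one-dimensional factors of the configuration space `𝔻^d`: the real line
`𝔻 = ℝ`, or the torus `𝔻 = ℝ / 2πℤ`. Functions on `(ℝ / 2πℤ)^d` are handled as functions on
`ℝ^d` that are `2π`-periodic in each coordinate. -/
inductive Factor : Type
  | line : Factor
  | torus : Factor

namespace Factor

/-- `u` is a function on `𝔻^d` (no condition if `𝔻 = ℝ`, periodicity if `𝔻 = ℝ / 2πℤ`). -/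
def IsFunction {d : ℕ} {β : Type} (D : Factor) (u : Space d → β) : Prop :=
  match D with
  | line => True
  | torus => ∀ (i : Fin d) (x : Space d),
      u (x + EuclideanSpace.single i (2 * Real.pi)) = u x

/-- Lebesgue measure on `𝔻^d`: on the torus, Lebesgue measure on the fundamental cube
`[-π, π)^d`. -/
def leb (D : Factor) (d : ℕ) : Measure (Space d) :=
  match D with
  | line => volume
  | torus => volume.restrict {x : Space d | ∀ i, x i ∈ Set.Ico (-Real.pi) Real.pi}

/-- The smooth functions on `𝔻^d`. -/
structure IsSmooth {d : ℕ} (D : Factor) (u : Space d → ℝ) : Prop where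
  isFunction : D.IsFunction u
  contDiff : ContDiff ℝ ∞ u

/-- The class `C_c^∞(𝔻^d)`; compactness of the support is automatic on the torus. -/
structure IsTest {d : ℕ} (D : Factor) (χ : Space d → ℝ) : Prop where
  isSmooth : D.IsSmooth χ
  hasCompactSupport : D = line → HasCompactSupport χ

end Factor

variable {d : ℕ}

/-- The normalization constant `∫_{𝔻^d} e^{-W}`. -/
def partitionFunction (D : Factor) (W : Space d → ℝ) : ℝ :=
  ∫ x, Real.exp (-W x) ∂(D.leb d)

/-- The measure `e^{-W} / ∫ e^{-W}` on `𝔻^d`. Thus `μ = gibbs D V` and `μ_U = gibbs D (V + U)`. -/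
def gibbs (D : Factor) (W : Space d → ℝ) : Measure (Space d) :=
  (D.leb d).tilted (fun x => -W x)

/-- `u ∈ H¹(μ_W)` with weak gradient `g`, where `μ_W = gibbs D W`. For continuous `W`, functions
in `L²(μ_W)` are square integrable on bounded sets, so the two integrals in `weak_gradient` are
convergent. -/
structure MemH1 (D : Factor) (W : Space d → ℝ) (u : Space d → ℝ) (g : Space d → Space d) :
    Prop where
  isFunction : D.IsFunction u
  isFunction_grad : D.IsFunction g
  memLp : MemLp u 2 (gibbs D W)
  memLp_grad : MemLp g 2 (gibbs D W)
  weak_gradient : ∀ χ : Space d → ℝ, D.IsTest χ →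
    ∫ x, u x • gradient χ x ∂(D.leb d) = -∫ x, χ x • g x ∂(D.leb d)

/-- `u ∈ H¹(μ_W) ∩ L²₀(μ_W)` with weak gradient `g`. -/
structure MemH1Zero (D : Factor) (W : Space d → ℝ) (u : Space d → ℝ) (g : Space d → Space d) :
    Prop where
  memH1 : MemH1 D W u g
  integral_eq_zero : ∫ x, u x ∂(gibbs D W) = 0

/-- The Poincaré inequality for `μ_W`. -/
def Poincare (D : Factor) (W : Space d → ℝ) : Prop :=
  ∃ R : ℝ, 0 < R ∧ ∀ (u : Space d → ℝ) (g : Space d → Space d), MemH1Zero D W u g →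
    ∫ x, u x ^ 2 ∂(gibbs D W) ≤ 1 / R * ∫ x, ‖g x‖ ^ 2 ∂(gibbs D W)

/-- `u`, with weak gradient `g`, is a weak solution in `H¹(μ_W) ∩ L²₀(μ_W)` of
`-Δu + ∇W · ∇u = h`, that is, of `-e^W ∇ · (e^{-W} ∇u) = h`. -/
structure IsWeakSolution (D : Factor) (W h : Space d → ℝ) (u : Space d → ℝ)
    (g : Space d → Space d) : Prop where
  memH1Zero : MemH1Zero D W u g
  weak_formulation : ∀ (χ : Space d → ℝ) (k : Space d → Space d), MemH1Zero D W χ k →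
    ∫ x, inner ℝ (g x) (k x) ∂(gibbs D W) = ∫ x, h x * χ x ∂(gibbs D W)

/-- There is exactly one weak solution of `-e^W ∇ · (e^{-W} ∇u) = h` in `H¹(μ_W) ∩ L²₀(μ_W)`, as
a class of functions modulo equality almost everywhere. -/
def WellPosed (D : Factor) (W h : Space d → ℝ) : Prop :=
  (∃ (u : Space d → ℝ) (g : Space d → Space d), IsWeakSolution D W h u g) ∧
  ∀ (u u' : Space d → ℝ) (g g' : Space d → Space d),
    IsWeakSolution D W h u g → IsWeakSolution D W h u' g' →
      u =ᵐ[D.leb d] u' ∧ g =ᵐ[D.leb d] g'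

/-- The standing assumptions on the potential `V` and the observable `f`. -/
structure IsTargetPair (D : Factor) (V f : Space d → ℝ) : Prop where
  smooth_potential : D.IsSmooth V
  integrable_exp : Integrable (fun x => Real.exp (-V x)) (D.leb d)
  smooth_observable : D.IsSmooth f
  integrable_observable : Integrable f (gibbs D V)

/-- The centred observable `f - I`, with `I = ∫ f dμ`. -/
def centredObservable (D : Factor) (V f : Space d → ℝ) : Space d → ℝ :=
  fun x => f x - ∫ y, f y ∂(gibbs D V)

/-- The right-hand side `(f - I) e^U` of the Poisson equation. -/
def poissonSource (D : Factor) (V f U : Space d → ℝ) : Space d → ℝ :=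
  fun x => centredObservable D V f x * Real.exp (U x)

/-- The admissible biasing potentials `𝔘₀(V, f)`. -/
structure IsAdmissible (D : Factor) (V f U : Space d → ℝ) : Prop where
  smooth : D.IsSmooth U
  integrable_exp : Integrable (fun x => Real.exp (-(V + U) x)) (D.leb d)
  poincare : Poincare D (V + U)
  memLp_source : MemLp (poissonSource D V f U) 2 (gibbs D (V + U))

/-- `u = φ_U`, with weak gradient `g = ∇φ_U`: the solution in `H¹(μ_U) ∩ L²₀(μ_U)` of
`-𝓛_U φ_U = (f - I) e^U`, where `𝓛_U = Δ - ∇(V + U) · ∇`. -/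
def IsPoissonSolution (D : Factor) (V f U : Space d → ℝ) (u : Space d → ℝ)
    (g : Space d → Space d) : Prop :=
  IsWeakSolution D (V + U) (poissonSource D V f U) u g

open Classical in
/-- The asymptotic variance `σ²_f[U] = 2 Z[U]² / Z² ∫ |∇φ_U|² dμ_U`, where `φ_U` is the solution
of the Poisson equation (it exists and is unique whenever `U ∈ 𝔘₀(V, f)`). -/
def asymptoticVariance (D : Factor) (V f U : Space d → ℝ) : ℝ :=
  if hex : ∃ p : (Space d → ℝ) × (Space d → Space d), IsPoissonSolution D V f U p.1 p.2 then
    2 * partitionFunction D (V + U) ^ 2 / partitionFunction D V ^ 2 *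
      ∫ x, ‖hex.choose.2 x‖ ^ 2 ∂(gibbs D (V + U))
  else 0

/-- The centred perturbation `δX₀ = δX - μ_U(δX)`. -/
def centre (D : Factor) (V U X : Space d → ℝ) : Space d → ℝ :=
  fun x => X x - ∫ y, X y ∂(gibbs D (V + U))

/-- The right-hand side `(f - I) e^U X - ∇X · ∇φ_U` of the perturbed Poisson equation in the
direction `X`, where `g = ∇φ_U`. -/
def perturbedSource (D : Factor) (V f U : Space d → ℝ) (g : Space d → Space d)
    (X : Space d → ℝ) : Space d → ℝ :=
  fun x => poissonSource D V f U x * X x - inner ℝ (gradient X x) (g x)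

/-- The positive weighted term of the second variation, where `g = ∇φ_U` and `X`, `Y` are the
centred perturbations. -/
def weightedTerm (D : Factor) (V U : Space d → ℝ) (g : Space d → Space d)
    (X Y : Space d → ℝ) : ℝ :=
  partitionFunction D (V + U) / partitionFunction D V ^ 2 *
    ∫ x, X x * Y x * (‖g x‖ ^ 2 + ∫ y, ‖g y‖ ^ 2 ∂(gibbs D (V + U))) *
      Real.exp (-(V + U) x) ∂(D.leb d)

/-- The subtracted term of the second variation, where `g = ∇φ_U`, `X`, `Y` are the centred
perturbations and `k = ∇ψ_{U,X}`, `l = ∇ψ_{U,Y}`. -/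
def gradientTerm (D : Factor) (V U : Space d → ℝ) (g : Space d → Space d)
    (X Y : Space d → ℝ) (k l : Space d → Space d) : ℝ :=
  2 * partitionFunction D (V + U) / partitionFunction D V ^ 2 *
    ∫ x, inner ℝ (k x - X x • g x) (l x - Y x • g x) * Real.exp (-(V + U) x) ∂(D.leb d)

end

/-!
On `H = H¹(μ_U) ∩ L²₀(μ_U)` a bounded weight `a` defines an operator `A_a` by
`⟪A_a u, v⟫ = ∫ a ∇u · ∇v dμ_U`, invertible by the Poincaré inequality when `a` is bounded below by
a positive constant. Replacing `U` by `U + b` with `b` bounded does not change `H` up to constants,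
and since `Z[U] ∫ (f - I) e^U v dμ_U = ∫ (f - I) v e^{-V}` with `f - I` of mean zero, the Poisson
equation for `U + b` reads `A_{e^{-b}} φ = r` with `r` independent of `b`. Hence
`σ²[U + b] = (2 Z[U]² / Z²) μ_U(e^{-b}) ⟪r, A_{e^{-b}}⁻¹ r⟫`, which is differentiated twice along
`b`; being homogeneous of degree zero in `e^{-b}`, it only sees centred perturbations, and
`ψ_{U,δX₀}` is the solution of `A_1 ψ = A_{δX₀} φ_U`.

On the line every compactly supported field is a gradient. Therefore `ψ' = δX₀ φ'`, the flux
`J = φ' e^{-V-U}` does not depend on `U`, and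
`σ²[U] = (2 / Z²) ∬ J(y)² e^{(V+U)(y) - (V+U)(x)} dx dy` is convex in `U`.
-/

open scoped BoundedContinuousFunction

noncomputable section

variable {d : ℕ}

/-! ### Dual energy of a linear family of operators -/

section DualEnergy

variable {𝔸 H : Type*} [NormedCommRing 𝔸] [NormedAlgebra ℝ 𝔸]
  [NormedAddCommGroup H] [InnerProductSpace ℝ H]

/-- The solution `p` of `form a p = r`; the junk value `0` if `form a` is not invertible. -/
def formSolve (form : 𝔸 →L[ℝ] H →L[ℝ] H) (r : H) (a : 𝔸) : H :=
  Ring.inverse (form a) r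

/-- The dual energy `⟪r, (form a)⁻¹ r⟫`, multiplied by the weight `mass a`; it is homogeneous of
degree zero in `a`. -/
def weightedDualEnergy (mass : 𝔸 →L[ℝ] ℝ) (form : 𝔸 →L[ℝ] H →L[ℝ] H) (r : H) (a : 𝔸) : ℝ :=
  mass a * inner ℝ r (formSolve form r a)

/-- The derivative of `weightedDualEnergy` at `a` in the direction `b`, for a symmetric `form`. -/
def weightedDualEnergyDeriv (mass : 𝔸 →L[ℝ] ℝ) (form : 𝔸 →L[ℝ] H →L[ℝ] H) (r : H)
    (a b : 𝔸) : ℝ :=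
  mass b * inner ℝ r (formSolve form r a) -
    mass a * inner ℝ (form b (formSolve form r a)) (formSolve form r a)

variable {mass : 𝔸 →L[ℝ] ℝ} {form : 𝔸 →L[ℝ] H →L[ℝ] H} {a : 𝔸}

theorem form_formSolve (ha : IsUnit (form a)) (r : H) : form a (formSolve form r a) = r :=
  DFunLike.congr_fun (Ring.mul_inverse_cancel _ ha) r

theorem formSolve_eq_iff (ha : IsUnit (form a)) {r p : H} :
    formSolve form r a = p ↔ form a p = r := by
  refine ⟨fun h => h ▸ form_formSolve ha r, fun h => ?_⟩
  rw [← h]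
  exact DFunLike.congr_fun (Ring.inverse_mul_cancel _ ha) p

theorem inner_formSolve (hsymm : ∀ x y, inner ℝ (form a x) y = inner ℝ x (form a y))
    (ha : IsUnit (form a)) (r q : H) : inner ℝ r (formSolve form q a) =
      inner ℝ (formSolve form r a) q := by
  conv_lhs => rw [← form_formSolve ha r]
  rw [hsymm, form_formSolve ha]

theorem weightedDualEnergy_smul (ha : IsUnit (form a)) (r : H) {c : ℝ} (hc : c ≠ 0) :
    weightedDualEnergy mass form r (c • a) = weightedDualEnergy mass form r a := by
  have hunit : IsUnit (form (c • a)) := by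
    rw [map_smul]
    exact ha.smul (Units.mk0 c hc)
  have hsolve : formSolve form r (c • a) = c⁻¹ • formSolve form r a := by
    rw [formSolve_eq_iff hunit, map_smul, map_smul, smul_apply,
      inv_smul_smul₀ hc, form_formSolve ha]
  rw [weightedDualEnergy, weightedDualEnergy, hsolve, map_smul, inner_smul_right, smul_eq_mul]
  field_simp

variable [CompleteSpace H] {c : ℝ → 𝔸} {c' : 𝔸} {t : ℝ}

theorem hasDerivAt_formSolve (hc : HasDerivAt c c' t) (hu : IsUnit (form (c t))) (r : H) :
    HasDerivAt (fun s => formSolve form r (c s))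
      (-formSolve form (form c' (formSolve form r (c t))) (c t)) t := by
  obtain ⟨T, hT⟩ := hu
  have hinv := hasFDerivAt_ringInverse (𝕜 := ℝ) T
  rw [← Ring.inverse_unit T, hT] at hinv
  have hcomp := hinv.comp_hasDerivAt t (form.hasFDerivAt.comp_hasDerivAt t hc)
  exact (hcomp.clm_apply (hasDerivAt_const t r)).congr_deriv (by simp [formSolve])

variable (hsymm : ∀ a x y, inner ℝ (form a x) y = inner ℝ x (form a y))
include hsymm

theorem hasDerivAt_weightedDualEnergy (hc : HasDerivAt c c' t) (hu : IsUnit (form (c t)))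
    (r : H) : HasDerivAt (fun s => weightedDualEnergy mass form r (c s))
      (weightedDualEnergyDeriv mass form r (c t) c') t := by
  have hmass := mass.hasFDerivAt.comp_hasDerivAt t hc
  have henergy := (hasDerivAt_const t r).inner ℝ (hasDerivAt_formSolve hc hu r)
  refine (hmass.mul henergy).congr_deriv ?_
  rw [inner_neg_right, inner_zero_left,
    inner_formSolve (hsymm _) hu r (form c' _), real_inner_comm (form c' _),
    weightedDualEnergyDeriv, Function.comp_apply]
  ring

theorem hasDerivAt_weightedDualEnergyDeriv {e : ℝ → 𝔸} {u w : 𝔸} (he : HasDerivAt e (-w) 0)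
    (he0 : e 0 = 1) (hone : IsUnit (form 1)) (hmass : mass 1 = 1) (hu : mass u = 0)
    (hw : mass w = 0) {γ η : H} (hη : form 1 η = form w γ) :
    HasDerivAt (fun s => weightedDualEnergyDeriv mass form (form 1 γ) (e s) (-(e s * u)))
      (mass (u * w) * inner ℝ (form 1 γ) γ - inner ℝ (form (u * w) γ) γ
        + 2 * inner ℝ (form u γ) η) 0 := by
  have hγ1 : formSolve form (form 1 γ) 1 = γ := (formSolve_eq_iff hone).2 rfl
  have hsolve : HasDerivAt (fun s => formSolve form (form 1 γ) (e s)) η 0 := by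
    convert! hasDerivAt_formSolve he (by rwa [he0]) (form 1 γ) using 1
    rw [he0, hγ1, eq_comm, neg_eq_iff_eq_neg, formSolve_eq_iff hone]
    simp [hη]
  have hdir : HasDerivAt (fun s => -(e s * u)) (u * w) 0 :=
    (he.mul_const u).neg.congr_deriv (by ring)
  have hmass_dir := mass.hasFDerivAt.comp_hasDerivAt (0 : ℝ) hdir
  have hmass_e := mass.hasFDerivAt.comp_hasDerivAt (0 : ℝ) he
  have hform_dir := (form.hasFDerivAt.comp_hasDerivAt (0 : ℝ) hdir).clm_apply hsolve
  refine ((hmass_dir.mul ((hasDerivAt_const 0 (form 1 γ)).inner ℝ hsolve)).sub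
    (hmass_e.mul (hform_dir.inner ℝ hsolve))).congr_deriv ?_
  have hcross : inner ℝ (form u η) γ = inner ℝ (form u γ) η := by
    rw [hsymm, real_inner_comm]
  simp only [Function.comp_apply, he0, hγ1, one_mul, map_neg, hu, hw, hmass, neg_zero, zero_mul,
    neg_apply, inner_add_left, inner_neg_left, hcross, inner_zero_left]
  ring

end DualEnergy

/-! ### Functions on `𝔻^d` -/

/-- The fundamental cube `[-π, π)^d` of the torus. -/
def fundamentalCube (d : ℕ) : Set (Space d) := {x | ∀ i, x i ∈ Set.Ico (-Real.pi) Real.pi}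

/-- The representative in the fundamental cube of a point of `ℝ^d` modulo `2π`. -/
def wrap (x : Space d) : Space d :=
  WithLp.toLp 2 fun i => toIcoMod Real.two_pi_pos (-Real.pi) (x i)

theorem toLp_preimage_fundamentalCube :
    WithLp.toLp 2 ⁻¹' fundamentalCube d =
      Set.univ.pi fun _ : Fin d => Set.Ico (-Real.pi) Real.pi := by
  ext x
  simp [fundamentalCube]

theorem wrap_mem (x : Space d) : wrap x ∈ fundamentalCube d := fun i => by
  have h := toIcoMod_mem_Ico Real.two_pi_pos (-Real.pi) (x i)
  exact ⟨h.1, h.2.trans_eq (by ring)⟩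

theorem wrap_eq_self {x : Space d} (hx : x ∈ fundamentalCube d) : wrap x = x := by
  ext i
  exact (toIcoMod_eq_self Real.two_pi_pos).2 ⟨(hx i).1, (hx i).2.trans_eq (by ring)⟩

theorem wrap_add_single (i : Fin d) (x : Space d) :
    wrap (x + EuclideanSpace.single i (2 * Real.pi)) = wrap x := by
  ext j
  by_cases h : j = i
  · subst h; simp [wrap]
  · simp [wrap, h]

theorem norm_wrap_le (x : Space d) : ‖wrap x‖ ≤ √d * Real.pi := by
  have hcoord (i : Fin d) : ‖wrap x i‖ ≤ Real.pi :=
    abs_le.2 ⟨(wrap_mem x i).1, (wrap_mem x i).2.le⟩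
  rw [EuclideanSpace.norm_eq]
  calc √(∑ i, ‖wrap x i‖ ^ 2) ≤ √(∑ _i : Fin d, Real.pi ^ 2) := by
        gcongr with i
        exact hcoord i
    _ = √d * Real.pi := by simp [Real.sqrt_sq Real.pi_pos.le]

theorem measurableSet_fundamentalCube : MeasurableSet (fundamentalCube d) := by
  simp only [fundamentalCube, Set.ofPred_forall]
  exact MeasurableSet.iInter fun i => measurableSet_Ico.preimage (by fun_prop)

theorem volume_fundamentalCube :
    volume (fundamentalCube d) = ENNReal.ofReal (2 * Real.pi) ^ d := by
  rw [← (PiLp.volume_preserving_toLp (Fin d)).measure_preimage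
    measurableSet_fundamentalCube.nullMeasurableSet, toLp_preimage_fundamentalCube,
    Real.volume_pi_Ico]
  simp [two_mul]

namespace Factor

variable {D : Factor} {β γ δ : Type}

theorem IsFunction.apply_wrap {u : Space d → β} (hu : torus.IsFunction u) (x : Space d) :
    u (wrap x) = u x := by
  have hperiodic (s : Finset (Fin d)) (n : Fin d → ℤ) :
      Function.Periodic u (∑ i ∈ s, n i • EuclideanSpace.single i (2 * Real.pi)) := by
    induction s using Finset.induction_on with
    | empty => exact fun x => by simp
    | insert i s hi ih =>
      rw [Finset.sum_insert hi]
      exact (Function.Periodic.zsmul (hu i) _).add_period ih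
  rw [← hperiodic Finset.univ (fun i => toIcoDiv Real.two_pi_pos (-Real.pi) (x i)) (wrap x)]
  congr 1
  ext j
  simp only [PiLp.add_apply, WithLp.ofLp_sum, Finset.sum_apply, PiLp.smul_apply]
  rw [Finset.sum_eq_single j (fun k _ hk => by simp [Ne.symm hk]) (by simp)]
  simp [wrap]

theorem exists_isFunction_ae_eq (D : Factor) (u : Space d → β) :
    ∃ v : Space d → β, D.IsFunction v ∧ v =ᵐ[D.leb d] u := by
  cases D with
  | line => exact ⟨u, trivial, Filter.EventuallyEq.rfl⟩
  | torus =>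
    refine ⟨fun x => u (wrap x), fun i x => by simp only [wrap_add_single], ?_⟩
    exact (ae_restrict_iff' measurableSet_fundamentalCube).2
      (.of_forall fun x hx => by simp only [wrap_eq_self hx])

theorem isFunction_const (c : β) : D.IsFunction (fun _ : Space d => c) := by
  cases D <;> simp [IsFunction]

theorem IsFunction.comp {u : Space d → β} (hu : D.IsFunction u) (F : β → γ) :
    D.IsFunction (fun x => F (u x)) := by
  cases D with
  | line => trivial
  | torus => exact fun i x => congrArg F (hu i x)

theorem IsFunction.comp₂ {u : Space d → β} {v : Space d → γ} (hu : D.IsFunction u)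
    (hv : D.IsFunction v) (F : β → γ → δ) : D.IsFunction (fun x => F (u x) (v x)) := by
  cases D with
  | line => trivial
  | torus => exact fun i x => congrArg₂ F (hu i x) (hv i x)

protected theorem IsFunction.gradient {u : Space d → ℝ} (hu : D.IsFunction u) :
    D.IsFunction (gradient u) := by
  cases D with
  | line => trivial
  | torus =>
    intro i x
    have h : (fun y => u (y + EuclideanSpace.single i (2 * Real.pi))) = u := funext (hu i)
    conv_rhs => rw [gradient, ← h, fderiv_comp_add_right, ← gradient]

theorem IsFunction.exists_bound {F : Type} [NormedAddCommGroup F] {u : Space d → F}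
    (hu : D.IsFunction u) (hc : Continuous u) (hs : D = line → HasCompactSupport u) :
    ∃ C, ∀ x, ‖u x‖ ≤ C := by
  cases D with
  | line => exact (hs rfl).exists_bound_of_continuous hc
  | torus =>
    obtain ⟨C, hC⟩ := (ProperSpace.isCompact_closedBall (0 : Space d)
      (√d * Real.pi)).exists_bound_of_continuousOn hc.continuousOn
    refine ⟨C, fun x => ?_⟩
    rw [← hu.apply_wrap x]
    exact hC _ (mem_closedBall_zero_iff.2 (norm_wrap_le x))

theorem isSmooth_const (c : ℝ) : D.IsSmooth (fun _ : Space d => c) :=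
  ⟨isFunction_const c, contDiff_const⟩

section IsSmooth

variable {u v : Space d → ℝ}

theorem IsSmooth.sub (hu : D.IsSmooth u) (hv : D.IsSmooth v) : D.IsSmooth (fun x => u x - v x) :=
  ⟨hu.isFunction.comp₂ hv.isFunction (· - ·), hu.contDiff.sub hv.contDiff⟩

theorem IsSmooth.mul (hu : D.IsSmooth u) (hv : D.IsSmooth v) : D.IsSmooth (fun x => u x * v x) :=
  ⟨hu.isFunction.comp₂ hv.isFunction (· * ·), hu.contDiff.mul hv.contDiff⟩

protected theorem IsSmooth.continuous (hu : D.IsSmooth u) : Continuous u :=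
  hu.contDiff.continuous

protected theorem IsSmooth.differentiable (hu : D.IsSmooth u) : Differentiable ℝ u :=
  hu.contDiff.differentiable (by simp)

theorem IsSmooth.continuous_gradient (hu : D.IsSmooth u) : Continuous (gradient u) :=
  (InnerProductSpace.toDual ℝ (Space d)).symm.continuous.comp
    (hu.contDiff.continuous_fderiv (by simp))

end IsSmooth

section IsTest

variable {χ : Space d → ℝ}

theorem IsTest.smooth_mul {u : Space d → ℝ} (hu : D.IsSmooth u) (hχ : D.IsTest χ) :
    D.IsTest (fun x => u x * χ x) :=
  ⟨hu.mul hχ.isSmooth, fun h => (hχ.hasCompactSupport h).mul_left⟩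

theorem IsTest.exists_bound (hχ : D.IsTest χ) : ∃ C, ∀ x, ‖χ x‖ ≤ C :=
  hχ.isSmooth.isFunction.exists_bound hχ.isSmooth.continuous hχ.hasCompactSupport

theorem IsTest.hasCompactSupport_gradient (hχ : D.IsTest χ) (hD : D = line) :
    HasCompactSupport (gradient χ) :=
  ((hχ.hasCompactSupport hD).fderiv (𝕜 := ℝ)).comp_left
    (map_zero (InnerProductSpace.toDual ℝ (Space d)).symm)

theorem IsTest.exists_bound_gradient (hχ : D.IsTest χ) : ∃ C, ∀ x, ‖gradient χ x‖ ≤ C :=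
  hχ.isSmooth.isFunction.gradient.exists_bound hχ.isSmooth.continuous_gradient
    hχ.hasCompactSupport_gradient

/-- A test function as a bounded continuous function. -/
def IsTest.toBCF (hχ : D.IsTest χ) : Space d →ᵇ ℝ :=
  BoundedContinuousFunction.ofNormedAddCommGroup χ hχ.isSmooth.continuous hχ.exists_bound.choose
    hχ.exists_bound.choose_spec

end IsTest

end Factor

theorem gradient_mul {u v : Space d → ℝ} {x : Space d} (hu : DifferentiableAt ℝ u x)
    (hv : DifferentiableAt ℝ v x) :
    gradient (fun y => u y * v y) x = u x • gradient v x + v x • gradient u x := by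
  simp [gradient, fderiv_fun_mul hu hv]

theorem gradient_sub_const (u : Space d → ℝ) (c : ℝ) :
    gradient (fun x => u x - c) = gradient u := by
  ext1 x
  simp only [gradient, fderiv_sub_const]

/-! ### Integration on `𝔻^d` -/

namespace Factor

variable {D : Factor}

theorem leb_torus_univ : torus.leb d Set.univ = ENNReal.ofReal (2 * Real.pi) ^ d := by
  rw [← volume_fundamentalCube]
  exact Measure.restrict_apply_univ _

instance : IsFiniteMeasure (torus.leb d) :=
  ⟨leb_torus_univ.trans_lt (ENNReal.pow_lt_top ENNReal.ofReal_lt_top)⟩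

instance (D : Factor) : IsFiniteMeasureOnCompacts (D.leb d) := by
  cases D with
  | line => exact inferInstanceAs (IsFiniteMeasureOnCompacts volume)
  | torus => infer_instance

instance (D : Factor) : SigmaFinite (D.leb d) := by
  cases D with
  | line => exact inferInstanceAs (SigmaFinite volume)
  | torus => infer_instance

instance (D : Factor) : NeZero (D.leb d) := by
  cases D with
  | line => exact inferInstanceAs (NeZero volume)
  | torus =>
    refine ⟨Measure.measure_univ_ne_zero.1 ?_⟩
    rw [leb_torus_univ]
    exact (ENNReal.pow_pos (ENNReal.ofReal_pos.2 Real.two_pi_pos) d).ne'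

theorem IsFunction.integrable {F : Type} [NormedAddCommGroup F] {u : Space d → F}
    (hu : D.IsFunction u) (hc : Continuous u) (hs : D = line → HasCompactSupport u) :
    Integrable u (D.leb d) := by
  cases D with
  | line => exact hc.integrable_of_hasCompactSupport (hs rfl)
  | torus =>
    obtain ⟨C, hC⟩ := hu.exists_bound hc hs
    exact .of_bound hc.aestronglyMeasurable C (.of_forall hC)

end Factor

theorem setIntegral_Icc_fderiv_single_eq_zero {n : ℕ} {a b : Fin (n + 1) → ℝ} (hab : a ≤ b)
    {u : (Fin (n + 1) → ℝ) → ℝ} (hu : ContDiff ℝ 1 u) (i : Fin (n + 1))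
    (hfaces : ∀ y : Fin n → ℝ, u (i.insertNth (b i) y) = u (i.insertNth (a i) y)) :
    ∫ x in Set.Icc a b, fderiv ℝ u x (Pi.single i 1) = 0 := by
  let F := ContinuousLinearMap.single ℝ (fun _ : Fin (n + 1) => ℝ) i
  have hdiv (x : Fin (n + 1) → ℝ) :
      ∑ j, (F.comp (fderiv ℝ u x)) (Pi.single j 1) j = fderiv ℝ u x (Pi.single i 1) := by
    simp [F, Pi.single_apply]
  have hcont : Continuous fun x => fderiv ℝ u x (Pi.single i 1) :=
    (hu.continuous_fderiv one_ne_zero).clm_apply continuous_const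
  have hstokes := integral_divergence_of_hasFDerivAt_off_countable a b hab (fun x => F (u x))
    (fun x => F.comp (fderiv ℝ u x)) ∅ Set.countable_empty
    (F.continuous.comp hu.continuous).continuousOn
    (fun x _ => F.hasFDerivAt.comp x (hu.differentiable one_ne_zero x).hasFDerivAt)
    (by simpa only [hdiv] using hcont.continuousOn.integrableOn_compact isCompact_Icc)
  simp only [hdiv] at hstokes
  rw [hstokes]
  refine Finset.sum_eq_zero fun j _ => ?_
  by_cases hj : j = i
  · subst hj
    simp [hfaces]
  · simp [F, hj]

namespace Factor

variable {D : Factor} {χ : Space d → ℝ}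

theorem IsFunction.setIntegral_fundamentalCube_fderiv_single (hχ : torus.IsFunction χ)
    (hsmooth : ContDiff ℝ 1 χ) (i : Fin d) :
    ∫ x in fundamentalCube d, fderiv ℝ χ x (EuclideanSpace.single i 1) = 0 := by
  obtain ⟨n, rfl⟩ := Nat.exists_eq_succ_of_ne_zero i.pos.ne'
  let L : (Fin (n + 1) → ℝ) ≃L[ℝ] Space (n + 1) := (EuclideanSpace.equiv (Fin (n + 1)) ℝ).symm
  have hfderiv (y : Fin (n + 1) → ℝ) : fderiv ℝ χ (WithLp.toLp 2 y) (EuclideanSpace.single i 1) =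
      fderiv ℝ (χ ∘ L) y (Pi.single i 1) := by
    rw [L.comp_right_fderiv]
    rfl
  rw [← (PiLp.volume_preserving_toLp (Fin (n + 1))).setIntegral_preimage_emb
    (MeasurableEquiv.toLp 2 _).measurableEmbedding, toLp_preimage_fundamentalCube, volume_pi,
    setIntegral_congr_set Measure.univ_pi_Ico_ae_eq_Icc, ← volume_pi]
  simp only [hfderiv]
  refine setIntegral_Icc_fderiv_single_eq_zero
    (fun _ => neg_le_self Real.pi_pos.le) (hsmooth.comp L.contDiff) i fun y => ?_
  refine Eq.trans (congrArg χ ?_) (hχ i _)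
  ext k
  by_cases hk : k = i
  · subst hk
    simp [L, two_mul]
  · obtain ⟨k, rfl⟩ := Fin.exists_succAbove_eq hk
    simp [L]

theorem IsTest.integral_fderiv_single_eq_zero (hχ : D.IsTest χ) (i : Fin d) :
    ∫ x, fderiv ℝ χ x (EuclideanSpace.single i 1) ∂(D.leb d) = 0 := by
  cases D with
  | line =>
    have hcompact := hχ.hasCompactSupport rfl
    have hcont : Continuous fun x => fderiv ℝ χ x (EuclideanSpace.single i 1) :=
      (hχ.isSmooth.contDiff.continuous_fderiv (by simp)).clm_apply continuous_const
    have hparts := integral_mul_fderiv_eq_neg_fderiv_mul_of_integrable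
      (μ := (volume : Measure (Space d))) (f := fun _ => (1 : ℝ)) (g := χ)
      (v := EuclideanSpace.single i 1) (by simp)
      (by simpa using hcont.integrable_of_hasCompactSupport (hcompact.fderiv_apply ℝ _))
      (by simpa using hχ.isSmooth.continuous.integrable_of_hasCompactSupport hcompact)
      (fun _ _ => by fun_prop) (fun x _ => hχ.isSmooth.differentiable x)
    simpa [leb] using hparts
  | torus =>
    exact hχ.isSmooth.isFunction.setIntegral_fundamentalCube_fderiv_single
      (hχ.isSmooth.contDiff.of_le (by simp)) i

theorem IsTest.integrable_gradient (hχ : D.IsTest χ) : Integrable (gradient χ) (D.leb d) :=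
  hχ.isSmooth.isFunction.gradient.integrable hχ.isSmooth.continuous_gradient
    hχ.hasCompactSupport_gradient

theorem IsTest.integral_gradient_eq_zero (hχ : D.IsTest χ) :
    ∫ x, gradient χ x ∂(D.leb d) = 0 := by
  ext i
  have hcoord (x : Space d) : gradient χ x i = fderiv ℝ χ x (EuclideanSpace.single i 1) := by
    rw [← inner_gradient_left, EuclideanSpace.inner_single_right]
    simp
  have hcomm := (EuclideanSpace.proj (𝕜 := ℝ) i).integral_comp_comm hχ.integrable_gradient
  simp only [PiLp.proj_apply, hcoord, hχ.integral_fderiv_single_eq_zero] at hcomm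
  exact hcomm.symm

end Factor

/-! ### Gibbs measures -/

/-- A continuous potential `W` on `𝔻^d` with finite partition function `∫ e^{-W}`: the setting in
which `μ_W` is a probability measure equivalent to Lebesgue measure, with density locally bounded
above and below. -/
structure IsPotential (D : Factor) (W : Space d → ℝ) : Prop where
  isFunction : D.IsFunction W
  continuous : Continuous W
  integrable_exp : Integrable (fun x => Real.exp (-W x)) (D.leb d)

instance (D : Factor) (W : Space d → ℝ) : IsZeroOrProbabilityMeasure (gibbs D W) :=
  isZeroOrProbabilityMeasure_tilted

theorem partitionFunction_pos {D : Factor} {W : Space d → ℝ}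
    (hW : Integrable (fun x => Real.exp (-W x)) (D.leb d)) : 0 < partitionFunction D W :=
  integral_exp_pos hW

theorem partitionFunction_mul_integral_gibbs {D : Factor} {W : Space d → ℝ}
    (hW : Integrable (fun x => Real.exp (-W x)) (D.leb d)) (u : Space d → ℝ) :
    partitionFunction D W * ∫ x, u x ∂(gibbs D W) = ∫ x, u x * Real.exp (-W x) ∂(D.leb d) := by
  rw [gibbs, integral_tilted, ← integral_const_mul]
  refine integral_congr_ae (.of_forall fun x => ?_)
  change partitionFunction D W * (Real.exp (-W x) / partitionFunction D W * u x) = _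
  field_simp [(partitionFunction_pos hW).ne']

namespace IsPotential

variable {D : Factor} {W : Space d → ℝ}

theorem isProbabilityMeasure (hW : IsPotential D W) : IsProbabilityMeasure (gibbs D W) :=
  isProbabilityMeasure_tilted hW.integrable_exp

protected theorem partitionFunction_pos (hW : IsPotential D W) : 0 < partitionFunction D W :=
  _root_.partitionFunction_pos hW.integrable_exp

theorem ae_eq_iff (hW : IsPotential D W) {β : Type*} {u v : Space d → β} :
    u =ᵐ[gibbs D W] v ↔ u =ᵐ[D.leb d] v :=
  ⟨fun h => (absolutelyContinuous_tilted hW.integrable_exp).ae_le h,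
    fun h => (tilted_absolutelyContinuous _ _).ae_le h⟩

theorem integrable_bilin (hW : IsPotential D W) {E F G : Type} [NormedAddCommGroup E]
    [NormedSpace ℝ E] [NormedAddCommGroup F] [NormedSpace ℝ F] [NormedAddCommGroup G]
    [NormedSpace ℝ G] (B : E →L[ℝ] F →L[ℝ] G) {u : Space d → E} {θ : Space d → F}
    (hu : Integrable u (gibbs D W)) (hθ : D.IsFunction θ) (hc : Continuous θ)
    (hs : D = Factor.line → HasCompactSupport θ) :
    Integrable (fun x => B (u x) (θ x)) (D.leb d) := by
  have hWc := hW.continuous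
  obtain ⟨C, hC⟩ := Factor.IsFunction.exists_bound (D := D) (u := fun x => Real.exp (W x) • θ x)
    (hW.isFunction.comp₂ hθ fun a b => Real.exp a • b) (by fun_prop) fun h => (hs h).smul_left
  refine (B.integrable_of_bilin_of_bdd_right C ((integrable_tilted_iff hW.integrable_exp u).1 hu)
    (Continuous.aestronglyMeasurable (by fun_prop)) (.of_forall hC)).congr (.of_forall fun x => ?_)
  simp only [map_smul, smul_apply, smul_smul, ← Real.exp_add, add_neg_cancel,
    Real.exp_zero, one_smul]

theorem add_bounded (hW : IsPotential D W) {b : Space d →ᵇ ℝ} (hb : D.IsFunction b) :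
    IsPotential D (W + ⇑b) := by
  refine ⟨hW.isFunction.comp₂ hb (· + ·), hW.continuous.add b.continuous, ?_⟩
  have hbound (x : Space d) : ‖Real.exp (-b x)‖ ≤ Real.exp ‖b‖ := by
    rw [Real.norm_of_nonneg (Real.exp_pos _).le]
    exact Real.exp_le_exp.2 ((neg_le_abs _).trans (b.norm_coe_le_norm x))
  refine (hW.integrable_exp.mul_bdd (Continuous.aestronglyMeasurable (by fun_prop))
    (.of_forall hbound)).congr (.of_forall fun x => ?_)
  simp only [Pi.add_apply, neg_add, Real.exp_add]

theorem gibbs_add (hW : IsPotential D W) (b : Space d → ℝ) :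
    gibbs D (W + b) = (gibbs D W).tilted (fun x => -b x) := by
  rw [gibbs, gibbs, tilted_tilted hW.integrable_exp]
  congr 1
  ext x
  simp only [Pi.add_apply, neg_add]

theorem memLp_add_bounded (hW : IsPotential D W) (b : Space d →ᵇ ℝ) {E : Type*}
    [NormedAddCommGroup E] {u : Space d → E} {p : ENNReal} (hu : MemLp u p (gibbs D W)) :
    MemLp u p (gibbs D (W + ⇑b)) := by
  rw [hW.gibbs_add]
  refine hu.of_measure_le_smul
    (c := ENNReal.ofReal (Real.exp ‖b‖ / ∫ x, Real.exp (-b x) ∂(gibbs D W)))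
    ENNReal.ofReal_ne_top ?_
  rw [Measure.tilted, ← withDensity_const]
  refine withDensity_mono (.of_forall fun x => ENNReal.ofReal_le_ofReal ?_)
  gcongr
  exact (neg_le_abs _).trans (b.norm_coe_le_norm x)

end IsPotential

/-! ### Weighted Sobolev functions -/

namespace MemH1

variable {D : Factor} {W : Space d → ℝ} {u : Space d → ℝ} {g : Space d → Space d}

theorem add_bounded (hW : IsPotential D W) (b : Space d →ᵇ ℝ) (h : MemH1 D W u g) :
    MemH1 D (W + ⇑b) u g :=
  ⟨h.isFunction, h.isFunction_grad, hW.memLp_add_bounded b h.memLp,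
    hW.memLp_add_bounded b h.memLp_grad, h.weak_gradient⟩

theorem of_add_bounded (hW : IsPotential D W) {b : Space d →ᵇ ℝ} (hb : D.IsFunction b)
    (h : MemH1 D (W + ⇑b) u g) : MemH1 D W u g := by
  have hcancel := h.add_bounded (hW.add_bounded hb) (-b)
  rwa [add_assoc, BoundedContinuousFunction.coe_neg, add_neg_cancel, add_zero] at hcancel

theorem integrable_smul_gradient_test (hW : IsPotential D W) (h : MemH1 D W u g) {χ : Space d → ℝ}
    (hχ : D.IsTest χ) : Integrable (fun x => u x • gradient χ x) (D.leb d) :=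
  hW.integrable_bilin (ContinuousLinearMap.lsmul ℝ ℝ) (h.memLp.integrable one_le_two)
    hχ.isSmooth.isFunction.gradient hχ.isSmooth.continuous_gradient hχ.hasCompactSupport_gradient

theorem integrable_test_smul_grad (hW : IsPotential D W) (h : MemH1 D W u g) {χ : Space d → ℝ}
    (hχ : D.IsTest χ) : Integrable (fun x => χ x • g x) (D.leb d) :=
  hW.integrable_bilin (ContinuousLinearMap.lsmul ℝ ℝ).flip (h.memLp_grad.integrable one_le_two)
    hχ.isSmooth.isFunction hχ.isSmooth.continuous hχ.hasCompactSupport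

theorem sub_const (hW : IsPotential D W) (h : MemH1 D W u g) (c : ℝ) :
    MemH1 D W (fun x => u x - c) g := by
  refine ⟨h.isFunction.comp (· - c), h.isFunction_grad, h.memLp.sub (memLp_const c),
    h.memLp_grad, fun χ hχ => ?_⟩
  have hconst : Integrable (fun x => c • gradient χ x) (D.leb d) := hχ.integrable_gradient.smul c
  simp_rw [← h.weak_gradient χ hχ, sub_smul]
  rw [integral_sub (h.integrable_smul_gradient_test hW hχ) hconst, integral_smul,
    hχ.integral_gradient_eq_zero, smul_zero, sub_zero]

theorem memH1Zero_sub_integral (hW : IsPotential D W) (h : MemH1 D W u g) :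
    MemH1Zero D W (fun x => u x - ∫ y, u y ∂(gibbs D W)) g := by
  have := hW.isProbabilityMeasure
  refine ⟨h.sub_const hW _, ?_⟩
  rw [integral_sub (h.memLp.integrable one_le_two) (integrable_const _), integral_const,
    probReal_univ, one_smul, sub_self]

theorem weak_gradient_mul (hW : IsPotential D W) (h : MemH1 D W u g) {X χ : Space d → ℝ}
    (hX : D.IsSmooth X) (hχ : D.IsTest χ) :
    ∫ x, (X x * u x) • gradient χ x ∂(D.leb d) =
      -∫ x, χ x • (X x • g x + u x • gradient X x) ∂(D.leb d) := by
  have hXχ := hχ.smooth_mul hX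
  have hint_χ : Integrable (fun x => u x • (χ x • gradient X x)) (D.leb d) :=
    hW.integrable_bilin (ContinuousLinearMap.lsmul ℝ ℝ) (h.memLp.integrable one_le_two)
      (hχ.isSmooth.isFunction.comp₂ hX.isFunction.gradient (· • ·))
      (hχ.isSmooth.continuous.smul hX.continuous_gradient)
      fun e => (hχ.hasCompactSupport e).smul_right (f' := gradient X)
  have hint_Xχ := h.integrable_test_smul_grad hW hXχ
  have hgradient (x : Space d) : u x • gradient (fun y => X y * χ y) x =
      (X x * u x) • gradient χ x + u x • (χ x • gradient X x) := by
    rw [gradient_mul (hX.differentiable x) (hχ.isSmooth.differentiable x), smul_add, smul_smul,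
      mul_comm (u x)]
  have hint_grad : Integrable (fun x => (X x * u x) • gradient χ x) (D.leb d) := by
    refine ((h.integrable_smul_gradient_test hW hXχ).sub hint_χ).congr (.of_forall fun x => ?_)
    simp only [hgradient, add_sub_cancel_right, Pi.sub_apply]
  have hweak := h.weak_gradient _ hXχ
  simp only [hgradient] at hweak
  rw [integral_add hint_grad hint_χ] at hweak
  have hsplit (x : Space d) : χ x • (X x • g x + u x • gradient X x) =
      (X x * χ x) • g x + u x • (χ x • gradient X x) := by
    rw [smul_add, smul_smul, mul_comm (χ x), smul_comm]
  simp only [hsplit]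
  rw [integral_add hint_Xχ hint_χ, eq_sub_of_add_eq hweak]
  abel

theorem smooth_mul (hW : IsPotential D W) (h : MemH1 D W u g) {X : Space d → ℝ}
    (hX : D.IsSmooth X) (hX_top : MemLp X ⊤ (gibbs D W))
    (hX_grad_top : MemLp (gradient X) ⊤ (gibbs D W)) :
    MemH1 D W (fun x => X x * u x) (fun x => X x • g x + u x • gradient X x) where
  isFunction := hX.isFunction.comp₂ h.isFunction (· * ·)
  isFunction_grad := (hX.isFunction.comp₂ h.isFunction_grad (· • ·)).comp₂
    (h.isFunction.comp₂ hX.isFunction.gradient (· • ·)) (· + ·)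
  memLp := h.memLp.mul hX_top
  memLp_grad :=
    have hmul_grad : MemLp (X • g) 2 (gibbs D W) := h.memLp_grad.smul hX_top
    have hgrad_mul : MemLp (u • gradient X) 2 (gibbs D W) := hX_grad_top.smul h.memLp
    hmul_grad.add hgrad_mul
  weak_gradient _ hχ := h.weak_gradient_mul hW hX hχ

theorem of_isSmooth (hu : D.IsSmooth u) (hu2 : MemLp u 2 (gibbs D W))
    (hg2 : MemLp (gradient u) 2 (gibbs D W)) : MemH1 D W u (gradient u) := by
  refine ⟨hu.isFunction, hu.isFunction.gradient, hu2, hg2, fun χ hχ => ?_⟩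
  have hint_u : Integrable (fun x => u x • gradient χ x) (D.leb d) :=
    (hu.isFunction.comp₂ hχ.isSmooth.isFunction.gradient (· • ·)).integrable
      (hu.continuous.smul hχ.isSmooth.continuous_gradient)
      fun e => (hχ.hasCompactSupport_gradient e).smul_left (f := u)
  have hint_χ : Integrable (fun x => χ x • gradient u x) (D.leb d) :=
    (hχ.isSmooth.isFunction.comp₂ hu.isFunction.gradient (· • ·)).integrable
      (hχ.isSmooth.continuous.smul hu.continuous_gradient)
      fun e => (hχ.hasCompactSupport e).smul_right (f' := gradient u)
  have hproduct := (hχ.smooth_mul hu).integral_gradient_eq_zero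
  simp_rw [gradient_mul (hu.differentiable _) (hχ.isSmooth.differentiable _)] at hproduct
  rw [integral_add hint_u hint_χ] at hproduct
  exact eq_neg_of_add_eq_zero_left hproduct

end MemH1

/-! ### The Hilbert space `H¹(μ_W) ∩ L²₀(μ_W)` -/

/-- Pairs (function, vector field) of class `L²(μ_W)`. -/
abbrev L2Pair (D : Factor) (W : Space d → ℝ) : Type :=
  WithLp 2 (Lp ℝ 2 (gibbs D W) × Lp (Space d) 2 (gibbs D W))

section H1Zero

variable {D : Factor} {W : Space d → ℝ}

/-- The classes of `u` and `g` are the components of the pair `p`. -/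
def Represents (u : Space d → ℝ) (g : Space d → Space d) (p : L2Pair D W) : Prop :=
  p.fst =ᵐ[gibbs D W] u ∧ p.snd =ᵐ[gibbs D W] g

variable {u v : Space d → ℝ} {g k : Space d → Space d}

theorem Represents.inner_eq {p q : L2Pair D W} (hp : Represents u g p) (hq : Represents v k q) :
    inner ℝ p q = ∫ x, u x * v x ∂(gibbs D W) + ∫ x, inner ℝ (g x) (k x) ∂(gibbs D W) := by
  rw [WithLp.prod_inner_apply, L2.inner_def, L2.inner_def]
  congr 1
  · refine integral_congr_ae ?_
    filter_upwards [hp.1, hq.1] with x hpx hqx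
    exact (congrArg₂ (inner ℝ) hpx hqx).trans (mul_comm _ _)
  · refine integral_congr_ae ?_
    filter_upwards [hp.2, hq.2] with x hpx hqx
    exact congrArg₂ (inner ℝ) hpx hqx

theorem represents_toLp (hu : MemLp u 2 (gibbs D W)) (hg : MemLp g 2 (gibbs D W)) :
    Represents u g (WithLp.toLp 2 (hu.toLp u, hg.toLp g) : L2Pair D W) :=
  ⟨hu.coeFn_toLp, hg.coeFn_toLp⟩

variable (D W) in
/-- Pairs orthogonal to all `(u, ∇u)` with `u ∈ H¹(μ_W) ∩ L²₀(μ_W)`: the pair `(1, 0)` encodes the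
mean-zero condition, and the others encode the definition of the weak gradient. -/
def annihilators : Set (L2Pair D W) :=
  {p | Represents (fun _ => 1) (fun _ => 0) p ∨ ∃ (χ : Space d → ℝ) (v : Space d), D.IsTest χ ∧
    Represents (fun x => Real.exp (W x) * inner ℝ v (gradient χ x))
      (fun x => Real.exp (W x) • χ x • v) p}

variable (D W) in
/-- `H¹(μ_W) ∩ L²₀(μ_W)` as a closed subspace of `L²(μ_W) × L²(μ_W)^d`. -/
def h1Zero : Submodule ℝ (L2Pair D W) :=
  (Submodule.span ℝ (annihilators D W))ᗮ

instance (D : Factor) (W : Space d → ℝ) : CompleteSpace (h1Zero D W) :=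
  inferInstanceAs (CompleteSpace ↥(Submodule.span ℝ (annihilators D W))ᗮ)

theorem mem_h1Zero_iff {p : L2Pair D W} :
    p ∈ h1Zero D W ↔ ∀ q ∈ annihilators D W, inner ℝ q p = 0 := by
  refine ⟨fun h q hq => (Submodule.mem_orthogonal _ _).1 h q (Submodule.subset_span hq),
    fun h => (Submodule.mem_orthogonal _ _).2 fun q hq => ?_⟩
  have hle : Submodule.span ℝ (annihilators D W) ≤ (ℝ ∙ p)ᗮ :=
    Submodule.span_le.2 fun q hq => Submodule.mem_orthogonal_singleton_iff_inner_left.2 (h q hq)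
  exact Submodule.mem_orthogonal_singleton_iff_inner_left.1 (hle hq)

theorem inner_annihilator_eq (hW : IsPotential D W) (hu : Integrable u (gibbs D W))
    (hg : Integrable g (gibbs D W)) {χ : Space d → ℝ} (hχ : D.IsTest χ) (v : Space d) :
    partitionFunction D W *
      (∫ x, Real.exp (W x) * inner ℝ v (gradient χ x) * u x ∂(gibbs D W) +
        ∫ x, inner ℝ (Real.exp (W x) • χ x • v) (g x) ∂(gibbs D W)) =
    inner ℝ v (∫ x, u x • gradient χ x ∂(D.leb d) + ∫ x, χ x • g x ∂(D.leb d)) := by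
  have hint_u : Integrable (fun x => u x • gradient χ x) (D.leb d) :=
    hW.integrable_bilin (ContinuousLinearMap.lsmul ℝ ℝ) hu
    hχ.isSmooth.isFunction.gradient hχ.isSmooth.continuous_gradient hχ.hasCompactSupport_gradient
  have hint_g : Integrable (fun x => χ x • g x) (D.leb d) :=
    hW.integrable_bilin (ContinuousLinearMap.lsmul ℝ ℝ).flip hg
    hχ.isSmooth.isFunction hχ.isSmooth.continuous hχ.hasCompactSupport
  rw [mul_add, partitionFunction_mul_integral_gibbs hW.integrable_exp,
    partitionFunction_mul_integral_gibbs hW.integrable_exp,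
    inner_add_right, ← integral_inner (𝕜 := ℝ) hint_u, ← integral_inner (𝕜 := ℝ) hint_g]
  congr 1 <;> refine integral_congr_ae (.of_forall fun x => ?_)
  · simp only [inner_smul_right, Real.exp_neg]
    field_simp
  · simp only [inner_smul_right, real_inner_smul_left, Real.exp_neg]
    field_simp

theorem IsPotential.memLp_exp_smul (hW : IsPotential D W) {F : Type} [NormedAddCommGroup F]
    [NormedSpace ℝ F] {θ : Space d → F} (hθ : D.IsFunction θ) (hc : Continuous θ)
    (hs : D = Factor.line → HasCompactSupport θ) {p : ENNReal} :
    MemLp (fun x => Real.exp (W x) • θ x) p (gibbs D W) := by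
  have hcont : Continuous fun x => Real.exp (W x) • θ x :=
    (Real.continuous_exp.comp hW.continuous).smul hc
  obtain ⟨C, hC⟩ := Factor.IsFunction.exists_bound (D := D)
    (hW.isFunction.comp₂ hθ fun a b => Real.exp a • b) hcont fun h => (hs h).smul_left
  exact .of_bound hcont.aestronglyMeasurable C (.of_forall hC)

theorem exists_annihilator (hW : IsPotential D W) {χ : Space d → ℝ} (hχ : D.IsTest χ)
    (v : Space d) :
    ∃ p ∈ annihilators D W, Represents (fun x => Real.exp (W x) * inner ℝ v (gradient χ x))
      (fun x => Real.exp (W x) • χ x • v) p := by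
  have hgradient : MemLp (fun x => Real.exp (W x) * inner ℝ v (gradient χ x)) 2 (gibbs D W) :=
    hW.memLp_exp_smul (hχ.isSmooth.isFunction.gradient.comp (inner ℝ v))
      (continuous_const.inner hχ.isSmooth.continuous_gradient)
      fun h => (hχ.hasCompactSupport_gradient h).comp_left (g := inner ℝ v) (inner_zero_right v)
  have hvalue : MemLp (fun x => Real.exp (W x) • χ x • v) 2 (gibbs D W) :=
    hW.memLp_exp_smul (hχ.isSmooth.isFunction.comp (· • v))
      (hχ.isSmooth.continuous.smul continuous_const)
      fun h => (hχ.hasCompactSupport h).smul_right (f' := fun _ => v)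
  have hrep := represents_toLp hgradient hvalue
  exact ⟨_, Or.inr ⟨χ, v, hχ, hrep⟩, hrep⟩

theorem MemH1Zero.exists_represents (hW : IsPotential D W) (h : MemH1Zero D W u g) :
    ∃ p : h1Zero D W, Represents u g p.1 := by
  have hr := represents_toLp h.memH1.memLp h.memH1.memLp_grad
  refine ⟨⟨_, mem_h1Zero_iff.2 fun q hq => ?_⟩, hr⟩
  rcases hq with hq | ⟨χ, v, hχ, hq⟩ <;> rw [hq.inner_eq hr]
  · simp [h.integral_eq_zero]
  · have hpair := inner_annihilator_eq hW (h.memH1.memLp.integrable one_le_two)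
      (h.memH1.memLp_grad.integrable one_le_two) hχ v
    rw [h.memH1.weak_gradient χ hχ, neg_add_cancel, inner_zero_right] at hpair
    exact (mul_eq_zero.1 hpair).resolve_left hW.partitionFunction_pos.ne'

theorem Represents.memH1Zero (hW : IsPotential D W) (hu : D.IsFunction u) (hg : D.IsFunction g)
    {p : h1Zero D W} (hr : Represents u g p.1) : MemH1Zero D W u g := by
  have hu_lp : MemLp u 2 (gibbs D W) := (memLp_congr_ae hr.1).1 (Lp.memLp _)
  have hg_lp : MemLp g 2 (gibbs D W) := (memLp_congr_ae hr.2).1 (Lp.memLp _)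
  refine ⟨⟨hu, hg, hu_lp, hg_lp, fun χ hχ => ?_⟩, ?_⟩
  · rw [eq_neg_iff_add_eq_zero]
    refine ext_inner_left ℝ fun v => ?_
    obtain ⟨q, hq, hqr⟩ := exists_annihilator hW hχ v
    have horth := mem_h1Zero_iff.1 p.2 q hq
    rw [hqr.inner_eq hr] at horth
    rw [← inner_annihilator_eq hW (hu_lp.integrable one_le_two) (hg_lp.integrable one_le_two) hχ v,
      horth, mul_zero, inner_zero_right]
  · have hone := represents_toLp (D := D) (W := W) (memLp_const 1) (memLp_const 0)
    have horth := mem_h1Zero_iff.1 p.2 _ (Or.inl hone)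
    rw [hone.inner_eq hr] at horth
    simpa using horth

theorem exists_memH1Zero_represents (hW : IsPotential D W) (p : h1Zero D W) :
    ∃ (u : Space d → ℝ) (g : Space d → Space d), MemH1Zero D W u g ∧ Represents u g p.1 := by
  obtain ⟨u, hu, hue⟩ := D.exists_isFunction_ae_eq (p.1.fst : Space d → ℝ)
  obtain ⟨g, hg, hge⟩ := D.exists_isFunction_ae_eq (p.1.snd : Space d → Space d)
  have hr : Represents u g p.1 := ⟨(hW.ae_eq_iff.2 hue).symm, (hW.ae_eq_iff.2 hge).symm⟩
  exact ⟨u, g, hr.memH1Zero hW hu hg, hr⟩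

variable (D W) in
/-- The gradient on `H¹(μ_W) ∩ L²₀(μ_W)`. -/
def gradL : h1Zero D W →L[ℝ] Lp (Space d) 2 (gibbs D W) :=
  (WithLp.sndL 2 ℝ _ _).comp (h1Zero D W).subtypeL

variable (D W) in
/-- The inclusion of `H¹(μ_W) ∩ L²₀(μ_W)` in `L²(μ_W)`. -/
def valueL : h1Zero D W →L[ℝ] Lp ℝ 2 (gibbs D W) :=
  (WithLp.fstL 2 ℝ _ _).comp (h1Zero D W).subtypeL

/-- `r` is the Riesz representative of the functional `v ↦ ∫ h v dμ_W` on
`H¹(μ_W) ∩ L²₀(μ_W)`. -/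
def RepresentsSource (h : Space d → ℝ) (r : h1Zero D W) : Prop :=
  ∀ (q : h1Zero D W) (v : Space d → ℝ) (k : Space d → Space d), MemH1Zero D W v k →
    Represents v k q.1 → inner ℝ r q = ∫ x, h x * v x ∂(gibbs D W)

theorem exists_representsSource {h : Space d → ℝ} (hh : MemLp h 2 (gibbs D W)) :
    ∃ r : h1Zero D W, RepresentsSource h r := by
  refine ⟨ContinuousLinearMap.adjoint (valueL D W) (hh.toLp h), fun q v k _ hq => ?_⟩
  rw [ContinuousLinearMap.adjoint_inner_left, L2.inner_def]
  refine integral_congr_ae ?_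
  filter_upwards [hh.coeFn_toLp, hq.1] with x hhx hqx
  exact (congrArg₂ (inner ℝ) hhx hqx).trans (mul_comm _ _)

end H1Zero

/-! ### Weighted Dirichlet forms -/

theorem integrable_inner_of_memLp_two {α E : Type*} [MeasurableSpace α] {μ : Measure α}
    [NormedAddCommGroup E] [InnerProductSpace ℝ E] {f g : α → E} (hf : MemLp f 2 μ)
    (hg : MemLp g 2 μ) : Integrable (fun x => inner ℝ (f x) (g x)) μ :=
  memLp_one_iff_integrable.1 ((innerSL ℝ).memLp_of_bilin 1 hf hg)

section Forms

variable (D : Factor) (W : Space d → ℝ)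

/-- Multiplication of a vector field by a bounded continuous function. -/
def mulField : (Space d →ᵇ ℝ) →L[ℝ] Lp (Space d) 2 (gibbs D W) →L[ℝ] Lp (Space d) 2 (gibbs D W) :=
  ((ContinuousLinearMap.lsmul ℝ ℝ).holderL (gibbs D W) ⊤ 2 2).comp
    (BoundedContinuousFunction.toLp ⊤ (gibbs D W) ℝ)

/-- The operator `A_a` of the form `(u, v) ↦ ∫ a ∇u · ∇v dμ_W`, as a function of the weight `a`. -/
def gradForm : (Space d →ᵇ ℝ) →L[ℝ] h1Zero D W →L[ℝ] h1Zero D W :=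
  ((ContinuousLinearMap.postcomp _ (ContinuousLinearMap.adjoint (gradL D W))).comp
    (ContinuousLinearMap.precomp _ (gradL D W))).comp (mulField D W)

/-- The integral against `μ_W`. -/
def gibbsMean : (Space d →ᵇ ℝ) →L[ℝ] ℝ :=
  LinearMap.mkContinuous
    { toFun := fun a => ∫ x, a x ∂(gibbs D W)
      map_add' := fun a b => integral_add (a.integrable _) (b.integrable _)
      map_smul' := fun c _ => integral_const_mul c _ } ((gibbs D W).real Set.univ)
    fun a => a.norm_integral_le_mul_norm (gibbs D W)

variable {D W}

theorem gibbsMean_apply (a : Space d →ᵇ ℝ) : gibbsMean D W a = ∫ x, a x ∂(gibbs D W) := rfl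

theorem mulField_ae_eq (a : Space d →ᵇ ℝ) (g : Lp (Space d) 2 (gibbs D W)) :
    mulField D W a g =ᵐ[gibbs D W] fun x => a x • g x := by
  filter_upwards [(ContinuousLinearMap.lsmul ℝ ℝ).coeFn_holder (r := 2)
    (BoundedContinuousFunction.toLp ⊤ (gibbs D W) ℝ a) g,
    BoundedContinuousFunction.coeFn_toLp (p := ⊤) (gibbs D W) (𝕜 := ℝ) a] with x hmul ha
  rw [ha] at hmul
  exact hmul

variable {u v : Space d → ℝ} {g k : Space d → Space d}

theorem inner_gradForm {p q : h1Zero D W} (hp : Represents u g p.1) (hq : Represents v k q.1)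
    (a : Space d →ᵇ ℝ) :
    inner ℝ (gradForm D W a p) q = ∫ x, a x * inner ℝ (g x) (k x) ∂(gibbs D W) := by
  have hadjoint : inner ℝ (gradForm D W a p) q =
      inner ℝ (mulField D W a (gradL D W p)) (gradL D W q) :=
    ContinuousLinearMap.adjoint_inner_left (gradL D W) q (mulField D W a (gradL D W p))
  rw [hadjoint, L2.inner_def]
  refine integral_congr_ae ?_
  filter_upwards [mulField_ae_eq a (gradL D W p), hp.2, hq.2] with x hmul hpx hqx
  have hgp : (gradL D W p : Space d → Space d) x = g x := hpx
  have hgq : (gradL D W q : Space d → Space d) x = k x := hqx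
  rw [hmul, hgp, hgq, real_inner_smul_left]

theorem gradForm_symm (hW : IsPotential D W) (a : Space d →ᵇ ℝ) (p q : h1Zero D W) :
    inner ℝ (gradForm D W a p) q = inner ℝ p (gradForm D W a q) := by
  obtain ⟨u, g, -, hp⟩ := exists_memH1Zero_represents hW p
  obtain ⟨v, k, -, hq⟩ := exists_memH1Zero_represents hW q
  rw [real_inner_comm (gradForm D W a q) p, inner_gradForm hp hq, inner_gradForm hq hp]
  simp_rw [real_inner_comm (g _) (k _)]

theorem integrable_bcf_mul_inner (a : Space d →ᵇ ℝ) (hg : MemLp g 2 (gibbs D W))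
    (hk : MemLp k 2 (gibbs D W)) :
    Integrable (fun x => a x * inner ℝ (g x) (k x)) (gibbs D W) :=
  (integrable_inner_of_memLp_two hg hk).bdd_mul a.continuous.aestronglyMeasurable
    (.of_forall a.norm_coe_le_norm)

theorem isUnit_gradForm (hW : IsPotential D W) (hP : Poincare D W) {a : Space d →ᵇ ℝ} {c : ℝ}
    (hc : 0 < c) (ha : ∀ x, c ≤ a x) : IsUnit (gradForm D W a) := by
  obtain ⟨R, hR, hP⟩ := hP
  have hcoercive : 0 < c / (1 / R + 1) := by positivity
  refine ContinuousLinearMap.isUnit_of_forall_le_norm_inner_map _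
    (c := ⟨c / (1 / R + 1), hcoercive.le⟩) hcoercive fun p => ?_
  obtain ⟨u, g, h, hr⟩ := exists_memH1Zero_represents hW p
  have hnorm : ‖p‖ ^ 2 = ∫ x, u x ^ 2 ∂(gibbs D W) + ∫ x, ‖g x‖ ^ 2 ∂(gibbs D W) := by
    rw [← real_inner_self_eq_norm_sq, Submodule.coe_inner, hr.inner_eq hr]
    simp_rw [real_inner_self_eq_norm_sq, sq]
  have hlower : c * ∫ x, ‖g x‖ ^ 2 ∂(gibbs D W) ≤ inner ℝ (gradForm D W a p) p := by
    rw [inner_gradForm hr hr, ← integral_const_mul]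
    simp_rw [← real_inner_self_eq_norm_sq]
    exact integral_mono
      ((integrable_inner_of_memLp_two h.memH1.memLp_grad h.memH1.memLp_grad).const_mul c)
      (integrable_bcf_mul_inner a h.memH1.memLp_grad h.memH1.memLp_grad)
      fun x => mul_le_mul_of_nonneg_right (ha x) real_inner_self_nonneg
  refine le_trans ?_ (hlower.trans (le_abs_self _))
  change ‖p‖ ^ 2 * (c / (1 / R + 1)) ≤ _
  rw [hnorm, mul_div_assoc', div_le_iff₀ (by positivity), mul_comm, mul_assoc]
  gcongr
  linarith [hP u g h]

theorem isWeakSolution_iff (hW : IsPotential D W) {h : Space d → ℝ} {r : h1Zero D W}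
    (hr : RepresentsSource h r) (hu : MemH1Zero D W u g) {p : h1Zero D W}
    (hp : Represents u g p.1) : IsWeakSolution D W h u g ↔ gradForm D W 1 p = r := by
  constructor
  · intro hs
    refine ext_inner_right ℝ fun q => ?_
    obtain ⟨v, k, hv, hq⟩ := exists_memH1Zero_represents hW q
    rw [inner_gradForm hp hq, hr q v k hv hq, ← hs.weak_formulation v k hv]
    simp
  · intro he
    refine ⟨hu, fun v k hv => ?_⟩
    obtain ⟨q, hq⟩ := hv.exists_represents hW
    rw [← hr q v k hv hq, ← he, inner_gradForm hp hq]
    simp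

theorem RepresentsSource.wellPosed (hW : IsPotential D W) (hP : Poincare D W) {h : Space d → ℝ}
    {r : h1Zero D W} (hr : RepresentsSource h r) : WellPosed D W h := by
  have hbij := ContinuousLinearMap.isUnit_iff_bijective.1
    (isUnit_gradForm hW hP one_pos (a := 1) fun _ => le_rfl)
  constructor
  · obtain ⟨p, hp⟩ := hbij.2 r
    obtain ⟨u, g, hug, hrep⟩ := exists_memH1Zero_represents hW p
    exact ⟨u, g, (isWeakSolution_iff hW hr hug hrep).2 hp⟩
  · intro u u' g g' hs hs'
    obtain ⟨p, hp⟩ := hs.memH1Zero.exists_represents hW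
    obtain ⟨p', hp'⟩ := hs'.memH1Zero.exists_represents hW
    obtain rfl := hbij.1 (((isWeakSolution_iff hW hr hs.memH1Zero hp).1 hs).trans
      ((isWeakSolution_iff hW hr hs'.memH1Zero hp').1 hs').symm)
    exact ⟨hW.ae_eq_iff.1 (hp.1.symm.trans hp'.1), hW.ae_eq_iff.1 (hp.2.symm.trans hp'.2)⟩

attribute [irreducible] gradForm gibbsMean

end Forms

/-! ### The asymptotic variance along bounded perturbations -/

theorem exp_bcf_apply {α : Type*} [TopologicalSpace α] (a : α →ᵇ ℝ) (x : α) :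
    NormedSpace.exp a x = Real.exp (a x) := by
  let eval : (α →ᵇ ℝ) →+* ℝ :=
    { toFun := fun a => a x
      map_one' := rfl
      map_mul' := fun _ _ => rfl
      map_zero' := rfl
      map_add' := fun _ _ => rfl }
  rw [Real.exp_eq_exp_ℝ]
  exact NormedSpace.map_exp_of_mem_ball (𝕂 := ℝ) eval (continuous_eval_const (F := α →ᵇ ℝ) x) a
    ((NormedSpace.expSeries_radius_eq_top ℝ (α →ᵇ ℝ)).symm ▸ edist_lt_top _ _)

theorem exp_neg_norm_le_exp_bcf {α : Type*} [TopologicalSpace α] (a : α →ᵇ ℝ) (x : α) :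
    Real.exp (-‖a‖) ≤ NormedSpace.exp a x := by
  rw [exp_bcf_apply, Real.exp_le_exp]
  exact (abs_le.1 (a.norm_coe_le_norm x)).1

theorem isUnit_gradForm_exp {D : Factor} {W : Space d → ℝ} (hW : IsPotential D W)
    (hP : Poincare D W) (b : Space d →ᵇ ℝ) : IsUnit (gradForm D W (NormedSpace.exp b)) :=
  isUnit_gradForm hW hP (Real.exp_pos _) (exp_neg_norm_le_exp_bcf b)

section Source

variable {D : Factor} {V f U : Space d → ℝ}

theorem mul_integral_gibbs_add (hW : IsPotential D (V + U)) {b : Space d →ᵇ ℝ}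
    (hb : D.IsFunction b) (F : Space d → ℝ) :
    partitionFunction D (V + (U + ⇑b)) * ∫ x, F x ∂(gibbs D (V + (U + ⇑b))) =
      partitionFunction D (V + U) * ∫ x, NormedSpace.exp (-b) x * F x ∂(gibbs D (V + U)) := by
  rw [partitionFunction_mul_integral_gibbs hW.integrable_exp, ← add_assoc,
    partitionFunction_mul_integral_gibbs (hW.add_bounded hb).integrable_exp]
  refine integral_congr_ae (.of_forall fun x => ?_)
  simp only [exp_bcf_apply, Pi.add_apply, neg_add, Real.exp_add, BoundedContinuousFunction.coe_neg,
    Pi.neg_apply]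
  ring

theorem partitionFunction_add (hW : IsPotential D (V + U)) {b : Space d →ᵇ ℝ}
    (hb : D.IsFunction b) : partitionFunction D (V + (U + ⇑b)) =
      partitionFunction D (V + U) * gibbsMean D (V + U) (NormedSpace.exp (-b)) := by
  have := (hW.add_bounded hb).isProbabilityMeasure
  rw [add_assoc] at this
  simpa only [integral_const, probReal_univ, smul_eq_mul, mul_one, gibbsMean_apply]
    using mul_integral_gibbs_add hW hb fun _ => 1

theorem exp_smul_poissonSource_mul (χ : Space d → ℝ) (x : Space d) :
    Real.exp (-(V + U) x) • (poissonSource D V f U x * χ x) =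
      centredObservable D V f x * χ x * Real.exp (-V x) := by
  simp only [poissonSource, Pi.add_apply, neg_add, Real.exp_add, Real.exp_neg, smul_eq_mul]
  field_simp

theorem mul_integral_poissonSource_mul
    (hW : Integrable (fun x => Real.exp (-(V + U) x)) (D.leb d)) (χ : Space d → ℝ) :
    partitionFunction D (V + U) * ∫ x, poissonSource D V f U x * χ x ∂(gibbs D (V + U)) =
      ∫ x, centredObservable D V f x * χ x * Real.exp (-V x) ∂(D.leb d) := by
  rw [partitionFunction_mul_integral_gibbs hW]
  exact integral_congr_ae (.of_forall fun x =>
    (mul_comm _ _).trans (exp_smul_poissonSource_mul χ x))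

variable (hV : Integrable (fun x => Real.exp (-V x)) (D.leb d)) (hf : Integrable f (gibbs D V))
include hV hf

theorem integrable_centredObservable_mul_exp :
    Integrable (fun x => centredObservable D V f x * Real.exp (-V x)) (D.leb d) := by
  simpa only [centredObservable, smul_eq_mul, mul_comm, Pi.sub_apply] using
    (integrable_tilted_iff hV _).1 (hf.sub (integrable_const (∫ y, f y ∂(gibbs D V))))

theorem integral_centredObservable_mul_exp :
    ∫ x, centredObservable D V f x * Real.exp (-V x) ∂(D.leb d) = 0 := by
  have : IsProbabilityMeasure (gibbs D V) := isProbabilityMeasure_tilted hV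
  rw [← partitionFunction_mul_integral_gibbs hV]
  unfold centredObservable
  rw [integral_sub hf (integrable_const _), integral_const, probReal_univ, one_smul, sub_self,
    mul_zero]

theorem mul_integral_poissonSource_sub_const {U' : Space d → ℝ}
    (hU : Integrable (fun x => Real.exp (-(V + U) x)) (D.leb d))
    (hU' : Integrable (fun x => Real.exp (-(V + U') x)) (D.leb d)) {v : Space d → ℝ}
    (hv : Integrable (fun x => poissonSource D V f U x * v x) (gibbs D (V + U))) (c : ℝ) :
    partitionFunction D (V + U') *
        ∫ x, poissonSource D V f U' x * (v x - c) ∂(gibbs D (V + U')) =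
      partitionFunction D (V + U) * ∫ x, poissonSource D V f U x * v x ∂(gibbs D (V + U)) := by
  have hint : Integrable (fun x => centredObservable D V f x * v x * Real.exp (-V x))
      (D.leb d) := by
    simpa only [exp_smul_poissonSource_mul] using (integrable_tilted_iff hU _).1 hv
  have hsplit (x : Space d) : centredObservable D V f x * (v x - c) * Real.exp (-V x) =
      centredObservable D V f x * v x * Real.exp (-V x) -
        c * (centredObservable D V f x * Real.exp (-V x)) := by ring
  rw [mul_integral_poissonSource_mul hU, mul_integral_poissonSource_mul hU']
  simp_rw [hsplit]
  rw [integral_sub hint ((integrable_centredObservable_mul_exp hV hf).const_mul c),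
    integral_const_mul, integral_centredObservable_mul_exp hV hf, mul_zero, sub_zero]

variable (hW : IsPotential D (V + U)) (hsource : MemLp (poissonSource D V f U) 2 (gibbs D (V + U)))
include hW hsource

theorem IsPoissonSolution.integral_perturbedSource_mul {φ : Space d → ℝ} {g : Space d → Space d}
    (hφ : IsPoissonSolution D V f U φ g) {X : Space d → ℝ} (hX : D.IsSmooth X)
    (hX_top : MemLp X ⊤ (gibbs D (V + U))) (hX_grad_top : MemLp (gradient X) ⊤ (gibbs D (V + U)))
    {v : Space d → ℝ} {k : Space d → Space d} (hv : MemH1 D (V + U) v k) :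
    ∫ x, perturbedSource D V f U g X x * v x ∂(gibbs D (V + U)) =
      ∫ x, X x * inner ℝ (g x) (k x) ∂(gibbs D (V + U)) := by
  have hXv := hv.smooth_mul hW hX hX_top hX_grad_top
  have hg := hφ.memH1Zero.memH1.memLp_grad
  have hint_source : Integrable (fun x => poissonSource D V f U x * (X x * v x))
      (gibbs D (V + U)) := hsource.integrable_mul hXv.memLp
  have hint_grad : Integrable (fun x => X x * inner ℝ (g x) (k x)) (gibbs D (V + U)) := by
    simpa only [Pi.smul_apply', inner_smul_right] using
      integrable_inner_of_memLp_two hg (hv.memLp_grad.smul hX_top)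
  have hint_cross : Integrable (fun x => inner ℝ (gradient X x) (g x) * v x)
      (gibbs D (V + U)) := by
    simpa only [Pi.smul_apply', real_inner_smul_left, mul_comm] using
      integrable_inner_of_memLp_two (hX_grad_top.smul hv.memLp) hg
  have hweak : ∫ x, inner ℝ (g x) (X x • k x + v x • gradient X x) ∂(gibbs D (V + U)) =
      ∫ x, poissonSource D V f U x * (X x * v x) ∂(gibbs D (V + U)) := by
    rw [hφ.weak_formulation _ _ (hXv.memH1Zero_sub_integral hW)]
    exact mul_left_cancel₀ hW.partitionFunction_pos.ne' (mul_integral_poissonSource_sub_const hV hf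
      hW.integrable_exp hW.integrable_exp hint_source _)
  have hsplit_grad (x : Space d) : inner ℝ (g x) (X x • k x + v x • gradient X x) =
      X x * inner ℝ (g x) (k x) + inner ℝ (gradient X x) (g x) * v x := by
    rw [inner_add_right, inner_smul_right, inner_smul_right, real_inner_comm (gradient X x),
      mul_comm (v x)]
  have hsplit_source (x : Space d) : perturbedSource D V f U g X x * v x =
      poissonSource D V f U x * (X x * v x) - inner ℝ (gradient X x) (g x) * v x := by
    rw [perturbedSource, sub_mul, mul_assoc]
  simp_rw [hsplit_grad] at hweak
  rw [integral_add hint_grad hint_cross] at hweak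
  simp_rw [hsplit_source]
  rw [integral_sub hint_source hint_cross, ← hweak, add_sub_cancel_right]

variable {r : h1Zero D (V + U)} (hr : RepresentsSource (poissonSource D V f U) r)
  {b : Space d →ᵇ ℝ} (hb : D.IsFunction b)
include hr hb

theorem isPoissonSolution_add_iff {u u' : Space d → ℝ} {g : Space d → Space d}
    (hu : MemH1Zero D (V + (U + ⇑b)) u g) {p : h1Zero D (V + U)} (hp : Represents u' g p.1) :
    IsPoissonSolution D V f (U + ⇑b) u g ↔ gradForm D (V + U) (NormedSpace.exp (-b)) p = r := by
  have hWb := hW.add_bounded hb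
  have hint {v : Space d → ℝ} {k : Space d → Space d} (hv : MemH1 D (V + U) v k) :=
    hsource.integrable_mul hv.memLp
  constructor
  · refine fun hs => ext_inner_right ℝ fun q => ?_
    obtain ⟨v, k, hv, hq⟩ := exists_memH1Zero_represents hW q
    have hv' := (hv.memH1.add_bounded hW b).memH1Zero_sub_integral hWb
    rw [add_assoc] at hv' hWb
    rw [inner_gradForm hp hq, hr q v k hv hq]
    refine mul_left_cancel₀ hW.partitionFunction_pos.ne' ?_
    rw [← mul_integral_gibbs_add hW hb, hs.weak_formulation _ _ hv']
    exact mul_integral_poissonSource_sub_const hV hf hW.integrable_exp hWb.integrable_exp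
      (hint hv.memH1) _
  · refine fun he => ⟨hu, fun v k hv => ?_⟩
    rw [← add_assoc] at hv
    have hv' := (hv.memH1.of_add_bounded hW hb).memH1Zero_sub_integral hW
    obtain ⟨q, hq⟩ := hv'.exists_represents hW
    rw [add_assoc] at hWb
    refine mul_left_cancel₀ hWb.partitionFunction_pos.ne' ?_
    rw [mul_integral_gibbs_add hW hb, ← inner_gradForm hp hq, he, hr q _ _ hv' hq]
    have hshift := mul_integral_poissonSource_sub_const hV hf hW.integrable_exp
      hWb.integrable_exp (hint hv'.memH1) (-∫ y, v y ∂(gibbs D (V + U)))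
    simpa only [sub_neg_eq_add, sub_add_cancel] using hshift.symm

theorem exists_isPoissonSolution_add (hP : Poincare D (V + U)) :
    ∃ (u : Space d → ℝ) (g : Space d → Space d), IsPoissonSolution D V f (U + ⇑b) u g := by
  obtain ⟨u, g, hug, hrep⟩ := exists_memH1Zero_represents hW
    (formSolve (gradForm D (V + U)) r (NormedSpace.exp (-b)))
  have hu := (hug.memH1.add_bounded hW b).memH1Zero_sub_integral (hW.add_bounded hb)
  rw [add_assoc] at hu
  exact ⟨_, g, (isPoissonSolution_add_iff hV hf hW hsource hr hb hu hrep).2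
    (form_formSolve (isUnit_gradForm_exp hW hP _) r)⟩

theorem IsPoissonSolution.sq_partitionFunction_mul_energy (hP : Poincare D (V + U))
    {u : Space d → ℝ} {g : Space d → Space d} (h : IsPoissonSolution D V f (U + ⇑b) u g) :
    partitionFunction D (V + (U + ⇑b)) ^ 2 * ∫ x, ‖g x‖ ^ 2 ∂(gibbs D (V + (U + ⇑b))) =
      partitionFunction D (V + U) ^ 2 *
        weightedDualEnergy (gibbsMean D (V + U)) (gradForm D (V + U)) r
          (NormedSpace.exp (-b)) := by
  have hu := h.memH1Zero.memH1
  rw [← add_assoc] at hu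
  obtain ⟨p, hp⟩ :=
    ((hu.of_add_bounded hW hb).memH1Zero_sub_integral hW).exists_represents hW
  have hform := (isPoissonSolution_add_iff hV hf hW hsource hr hb h.memH1Zero hp).1 h
  have hsolve := (formSolve_eq_iff (isUnit_gradForm_exp hW hP (-b))).2 hform
  have henergy : inner ℝ r p =
      ∫ x, NormedSpace.exp (-b) x * ‖g x‖ ^ 2 ∂(gibbs D (V + U)) := by
    rw [← hform, inner_gradForm hp hp]
    simp_rw [real_inner_self_eq_norm_sq]
  rw [weightedDualEnergy, hsolve, henergy, sq, mul_assoc, mul_integral_gibbs_add hW hb,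
    partitionFunction_add hW hb]
  ring

theorem asymptoticVariance_add (hP : Poincare D (V + U)) :
    asymptoticVariance D V f (U + ⇑b) =
      2 * partitionFunction D (V + U) ^ 2 / partitionFunction D V ^ 2 *
        weightedDualEnergy (gibbsMean D (V + U)) (gradForm D (V + U)) r
          (NormedSpace.exp (-b)) := by
  have hex : ∃ p : (Space d → ℝ) × (Space d → Space d),
      IsPoissonSolution D V f (U + ⇑b) p.1 p.2 := by
    obtain ⟨u, g, h⟩ := exists_isPoissonSolution_add hV hf hW hsource hr hb hP
    exact ⟨(u, g), h⟩
  rw [asymptoticVariance, dif_pos hex, mul_div_right_comm, mul_div_right_comm, mul_assoc, mul_assoc,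
    hex.choose_spec.sq_partitionFunction_mul_energy hV hf hW hsource hr hb hP]

end Source

/-! ### The second variation -/

section SecondVariation

/-- The centred perturbation as a bounded continuous function. -/
def centreBCF (D : Factor) (W : Space d → ℝ) (a : Space d →ᵇ ℝ) : Space d →ᵇ ℝ :=
  a - gibbsMean D W a • 1

theorem coe_centreBCF (D : Factor) (V U : Space d → ℝ) (a : Space d →ᵇ ℝ) :
    ⇑(centreBCF D (V + U) a) = centre D V U a := by
  ext x
  simp [centreBCF, centre, gibbsMean_apply]

theorem Factor.IsTest.memLp_top_centre {D : Factor} {X : Space d → ℝ} (hX : D.IsTest X)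
    (V U : Space d → ℝ) : MemLp (centre D V U X) ⊤ (gibbs D (V + U)) := by
  have hcentre : centre D V U X = ⇑(centreBCF D (V + U) hX.toBCF) :=
    (coe_centreBCF D V U hX.toBCF).symm
  rw [hcentre]
  exact memLp_top_of_bound (BoundedContinuousFunction.continuous _).aestronglyMeasurable _
    (.of_forall (BoundedContinuousFunction.norm_coe_le_norm _))

theorem Factor.IsTest.memLp_top_gradient_centre {D : Factor} {X : Space d → ℝ} (hX : D.IsTest X)
    (V U : Space d → ℝ) : MemLp (gradient (centre D V U X)) ⊤ (gibbs D (V + U)) := by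
  obtain ⟨C, hC⟩ := hX.exists_bound_gradient
  have hgradient : gradient (centre D V U X) = gradient X := gradient_sub_const X _
  rw [hgradient]
  exact memLp_top_of_bound hX.isSmooth.continuous_gradient.aestronglyMeasurable C (.of_forall hC)

theorem gibbsMean_centreBCF {D : Factor} {W : Space d → ℝ} (hW : IsPotential D W)
    (a : Space d →ᵇ ℝ) : gibbsMean D W (centreBCF D W a) = 0 := by
  have := hW.isProbabilityMeasure
  have hone : gibbsMean D W 1 = 1 := by simp [gibbsMean_apply]
  rw [centreBCF, map_sub, map_smul, hone, smul_eq_mul, mul_one, sub_self]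

theorem hasDerivAt_exp_neg_add_smul {𝔸 : Type*} [NormedCommRing 𝔸] [NormedAlgebra ℝ 𝔸]
    [CompleteSpace 𝔸] (a u : 𝔸) :
    HasDerivAt (fun t : ℝ => NormedSpace.exp (-(a + t • u))) (-(NormedSpace.exp (-a) * u)) 0 := by
  have hline : HasDerivAt (fun t : ℝ => -(a + t • u)) (-u) 0 := by
    simpa using ((hasDerivAt_id (0 : ℝ)).smul_const u).const_add a |>.fun_neg
  exact ((hasFDerivAt_exp (𝕂 := ℝ)).comp_hasDerivAt (0 : ℝ) hline).congr_deriv (by simp)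

theorem exp_neg_sub_smul_one {𝔸 : Type*} [NormedCommRing 𝔸] [NormedAlgebra ℝ 𝔸]
    [CompleteSpace 𝔸] (a : 𝔸) (c : ℝ) :
    NormedSpace.exp (-(a - c • 1)) = Real.exp c • NormedSpace.exp (-a) := by
  let _ : NormedAlgebra ℚ 𝔸 := .restrictScalars ℚ ℝ 𝔸
  rw [neg_sub, sub_eq_add_neg, NormedSpace.exp_add, ← Algebra.algebraMap_eq_smul_one,
    ← NormedSpace.algebraMap_exp_comm, ← Real.exp_eq_exp_ℝ, Algebra.smul_def]

variable {D : Factor} {V f U φ : Space d → ℝ} {g : Space d → Space d}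

theorem weightedTerm_eq (hW : IsPotential D (V + U)) {γ : h1Zero D (V + U)}
    (hγ : Represents φ g γ.1) (a b : Space d →ᵇ ℝ) :
    weightedTerm D V U g a b = partitionFunction D (V + U) ^ 2 / partitionFunction D V ^ 2 *
      (inner ℝ (gradForm D (V + U) (a * b) γ) γ +
        gibbsMean D (V + U) (a * b) * inner ℝ (gradForm D (V + U) 1 γ) γ) := by
  have hg : MemLp g 2 (gibbs D (V + U)) := (memLp_congr_ae hγ.2).1 (Lp.memLp _)
  have hint := integrable_bcf_mul_inner (a * b) hg hg
  have hproduct : Integrable (fun x => a x * b x) (gibbs D (V + U)) := (a * b).integrable _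
  rw [weightedTerm, ← partitionFunction_mul_integral_gibbs hW.integrable_exp,
    inner_gradForm hγ hγ, inner_gradForm hγ hγ, gibbsMean_apply]
  simp_rw [real_inner_self_eq_norm_sq, BoundedContinuousFunction.mul_apply] at hint ⊢
  simp_rw [mul_add]
  rw [integral_add hint (hproduct.mul_const _), integral_mul_const]
  simp only [BoundedContinuousFunction.coe_one, Pi.one_apply, one_mul]
  ring

theorem integral_inner_sub_smul {W : Space d → ℝ} {k l : Space d → Space d}
    (hg : MemLp g 2 (gibbs D W)) (hk : MemLp k 2 (gibbs D W)) (hl : MemLp l 2 (gibbs D W))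
    (a b : Space d →ᵇ ℝ) :
    ∫ x, inner ℝ (k x - a x • g x) (l x - b x • g x) ∂(gibbs D W) =
      ∫ x, inner ℝ (k x) (l x) ∂(gibbs D W) - ∫ x, a x * inner ℝ (g x) (l x) ∂(gibbs D W) -
      (∫ x, b x * inner ℝ (g x) (k x) ∂(gibbs D W) -
        ∫ x, (a * b) x * inner ℝ (g x) (g x) ∂(gibbs D W)) := by
  have hexpand (x : Space d) : inner ℝ (k x - a x • g x) (l x - b x • g x) =
      inner ℝ (k x) (l x) - a x * inner ℝ (g x) (l x) -
        (b x * inner ℝ (g x) (k x) - (a * b) x * inner ℝ (g x) (g x)) := by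
    simp only [inner_sub_left, inner_sub_right, real_inner_smul_left, inner_smul_right,
      BoundedContinuousFunction.mul_apply, real_inner_comm (g x) (k x)]
    ring
  have hkl := integrable_inner_of_memLp_two hk hl
  have hgl := integrable_bcf_mul_inner a hg hl
  have hgk := integrable_bcf_mul_inner b hg hk
  have hgg := integrable_bcf_mul_inner (a * b) hg hg
  rw [← integral_sub hkl hgl, ← integral_sub hgk hgg]
  exact (integral_congr_ae (.of_forall hexpand)).trans (integral_sub (hkl.sub hgl) (hgk.sub hgg))

theorem gradientTerm_eq {ψ χ : Space d → ℝ} {k l : Space d → Space d}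
    (hW : IsPotential D (V + U)) {γ κ η : h1Zero D (V + U)} (hγ : Represents φ g γ.1)
    (hκ : Represents ψ k κ.1) (hη : Represents χ l η.1) {a b : Space d →ᵇ ℝ}
    (hκ_eq : gradForm D (V + U) 1 κ = gradForm D (V + U) a γ)
    (hη_eq : gradForm D (V + U) 1 η = gradForm D (V + U) b γ) :
    gradientTerm D V U g a b k l = partitionFunction D (V + U) ^ 2 / partitionFunction D V ^ 2 *
      (2 * (inner ℝ (gradForm D (V + U) (a * b) γ) γ -
        inner ℝ (gradForm D (V + U) a γ) η)) := by
  have hgl := inner_gradForm hγ hη a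
  have hgg := inner_gradForm hγ hγ (a * b)
  have hkl : inner ℝ (gradForm D (V + U) a γ) η =
      ∫ x, inner ℝ (k x) (l x) ∂(gibbs D (V + U)) := calc
    _ = inner ℝ (gradForm D (V + U) 1 κ) η := congrArg (inner ℝ · η) hκ_eq.symm
    _ = ∫ x, (1 : Space d →ᵇ ℝ) x * inner ℝ (k x) (l x) ∂(gibbs D (V + U)) :=
      inner_gradForm hκ hη 1
    _ = _ := integral_congr_ae (.of_forall fun x => one_mul _)
  have hgk : inner ℝ (gradForm D (V + U) a γ) η =
      ∫ x, b x * inner ℝ (g x) (k x) ∂(gibbs D (V + U)) := calc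
    _ = inner ℝ (gradForm D (V + U) 1 κ) η := congrArg (inner ℝ · η) hκ_eq.symm
    _ = inner ℝ κ (gradForm D (V + U) 1 η) := gradForm_symm hW 1 κ η
    _ = inner ℝ κ (gradForm D (V + U) b γ) := congrArg (inner ℝ κ) hη_eq
    _ = inner ℝ (gradForm D (V + U) b γ) κ := real_inner_comm _ _
    _ = _ := inner_gradForm hγ hκ b
  have hg : MemLp g 2 (gibbs D (V + U)) := (memLp_congr_ae hγ.2).1 (Lp.memLp _)
  have hk : MemLp k 2 (gibbs D (V + U)) := (memLp_congr_ae hκ.2).1 (Lp.memLp _)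
  have hl : MemLp l 2 (gibbs D (V + U)) := (memLp_congr_ae hη.2).1 (Lp.memLp _)
  have hexpand := integral_inner_sub_smul hg hk hl a b
  rw [gradientTerm, ← partitionFunction_mul_integral_gibbs hW.integrable_exp]
  linear_combination 2 * partitionFunction D (V + U) ^ 2 / partitionFunction D V ^ 2 *
    (hexpand - hkl + hgl + hgk - hgg)

theorem wellPosed_poissonSource (hW : IsPotential D (V + U))
    (hP : Poincare D (V + U)) (hsource : MemLp (poissonSource D V f U) 2 (gibbs D (V + U))) :
    WellPosed D (V + U) (poissonSource D V f U) := by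
  obtain ⟨r, hr⟩ := exists_representsSource hsource
  exact hr.wellPosed hW hP

variable (hV : Integrable (fun x => Real.exp (-V x)) (D.leb d)) (hf : Integrable f (gibbs D V))
  (hW : IsPotential D (V + U)) (hsource : MemLp (poissonSource D V f U) 2 (gibbs D (V + U)))
  (hP : Poincare D (V + U))
include hV hf hW hsource

include hP in
theorem asymptoticVariance_add_eq_sub_const {r : h1Zero D (V + U)}
    (hr : RepresentsSource (poissonSource D V f U) r) {b : Space d →ᵇ ℝ} (hb : D.IsFunction b)
    (c : ℝ) : asymptoticVariance D V f (U + ⇑b) =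
      2 * partitionFunction D (V + U) ^ 2 / partitionFunction D V ^ 2 *
        weightedDualEnergy (gibbsMean D (V + U)) (gradForm D (V + U)) r
          (NormedSpace.exp (-(b - c • 1))) := by
  rw [exp_neg_sub_smul_one, weightedDualEnergy_smul (isUnit_gradForm_exp hW hP (-b)) r
    (Real.exp_ne_zero c), asymptoticVariance_add hV hf hW hsource hr hb hP]

include hP in
theorem hasLineDerivAt_asymptoticVariance {r : h1Zero D (V + U)}
    (hr : RepresentsSource (poissonSource D V f U) r) {u w : Space d →ᵇ ℝ}
    (hu : D.IsFunction u) (hw : D.IsFunction w) (s : ℝ) :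
    HasLineDerivAt ℝ (asymptoticVariance D V f)
      (2 * partitionFunction D (V + U) ^ 2 / partitionFunction D V ^ 2 *
        weightedDualEnergyDeriv (gibbsMean D (V + U)) (gradForm D (V + U)) r
          (NormedSpace.exp (-(s • centreBCF D (V + U) w)))
          (-(NormedSpace.exp (-(s • centreBCF D (V + U) w)) * centreBCF D (V + U) u)))
      (U + s • ⇑w) u := by
  have hexp := hasDerivAt_exp_neg_add_smul (s • centreBCF D (V + U) w) (centreBCF D (V + U) u)
  have henergy := hasDerivAt_weightedDualEnergy (mass := gibbsMean D (V + U)) (gradForm_symm hW)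
    hexp (isUnit_gradForm_exp hW hP _) r
  simp only [zero_smul, add_zero] at henergy
  refine (henergy.const_mul _).congr_of_eventuallyEq (.of_forall fun t => ?_)
  have hsum : D.IsFunction ⇑(s • w + t • u) := hw.comp₂ hu fun a b => s • a + t • b
  have hcentre : s • centreBCF D (V + U) w + t • centreBCF D (V + U) u =
      s • w + t • u - (s * gibbsMean D (V + U) w + t * gibbsMean D (V + U) u) • 1 := by
    simp only [centreBCF, smul_sub, add_smul, smul_smul]
    abel
  have hline : U + s • ⇑w + t • ⇑u = U + ⇑(s • w + t • u) := add_assoc _ _ _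
  simp only [hcentre, hline]
  exact asymptoticVariance_add_eq_sub_const hV hf hW hsource hP hr hsum _

include hP in
theorem hasLineDerivAt_lineDeriv_asymptoticVariance {γ η : h1Zero D (V + U)}
    (hγ : RepresentsSource (poissonSource D V f U) (gradForm D (V + U) 1 γ))
    {u w : Space d →ᵇ ℝ} (hu : D.IsFunction u) (hw : D.IsFunction w)
    (hη : gradForm D (V + U) 1 η = gradForm D (V + U) (centreBCF D (V + U) w) γ) :
    HasLineDerivAt ℝ (fun U' => 1 / 2 * lineDeriv ℝ (asymptoticVariance D V f) U' u)
      (partitionFunction D (V + U) ^ 2 / partitionFunction D V ^ 2 *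
        (gibbsMean D (V + U) (centreBCF D (V + U) u * centreBCF D (V + U) w) *
            inner ℝ (gradForm D (V + U) 1 γ) γ
          - inner ℝ (gradForm D (V + U) (centreBCF D (V + U) u * centreBCF D (V + U) w) γ) γ
          + 2 * inner ℝ (gradForm D (V + U) (centreBCF D (V + U) u) γ) η)) U w := by
  have := hW.isProbabilityMeasure
  have hexp : HasDerivAt (fun s : ℝ => NormedSpace.exp (-(s • centreBCF D (V + U) w)))
      (-centreBCF D (V + U) w) 0 := by
    simpa using hasDerivAt_exp_neg_add_smul 0 (centreBCF D (V + U) w)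
  have henergy := hasDerivAt_weightedDualEnergyDeriv (mass := gibbsMean D (V + U))
    (gradForm_symm hW) hexp (by simp) (isUnit_gradForm hW hP one_pos fun _ => le_rfl)
    (by simp [gibbsMean_apply]) (gibbsMean_centreBCF hW u) (gibbsMean_centreBCF hW w) hη
  refine (henergy.const_mul _).congr_of_eventuallyEq (.of_forall fun s => ?_)
  simp only [(hasLineDerivAt_asymptoticVariance hV hf hW hsource hP hγ hu hw s).lineDeriv]
  ring

theorem IsPoissonSolution.integral_perturbedSource_centre_mul
    (hφ : IsPoissonSolution D V f U φ g) {X : Space d → ℝ} (hX : D.IsTest X) {v : Space d → ℝ}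
    {k : Space d → Space d} (hv : MemH1 D (V + U) v k) :
    ∫ x, perturbedSource D V f U g (centre D V U X) x * v x ∂(gibbs D (V + U)) =
      ∫ x, centre D V U X x * inner ℝ (g x) (k x) ∂(gibbs D (V + U)) :=
  hφ.integral_perturbedSource_mul hV hf hW hsource
    (hX.isSmooth.sub (Factor.isSmooth_const _)) (hX.memLp_top_centre V U)
    (hX.memLp_top_gradient_centre V U) hv

theorem IsPoissonSolution.representsSource_perturbedSource (hφ : IsPoissonSolution D V f U φ g)
    {γ : h1Zero D (V + U)} (hγ : Represents φ g γ.1) {X : Space d → ℝ} (hX : D.IsTest X) :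
    RepresentsSource (perturbedSource D V f U g (centre D V U X))
      (gradForm D (V + U) (centreBCF D (V + U) hX.toBCF) γ) := by
  intro q v k hv hq
  have hcentre : ⇑(centreBCF D (V + U) hX.toBCF) = centre D V U X := coe_centreBCF D V U hX.toBCF
  rw [inner_gradForm hγ hq, hcentre,
    hφ.integral_perturbedSource_centre_mul hV hf hW hsource hX hv.memH1]

include hP in
theorem IsPoissonSolution.wellPosed_perturbedSource (hφ : IsPoissonSolution D V f U φ g)
    {X : Space d → ℝ} (hX : D.IsTest X) :
    WellPosed D (V + U) (perturbedSource D V f U g (centre D V U X)) := by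
  obtain ⟨γ, hγ⟩ := hφ.memH1Zero.exists_represents hW
  exact (hφ.representsSource_perturbedSource hV hf hW hsource hγ hX).wellPosed hW hP

include hP in
theorem lineDifferentiableAt_asymptoticVariance {X Y : Space d → ℝ} (hX : D.IsTest X)
    (hY : D.IsTest Y) (s : ℝ) :
    LineDifferentiableAt ℝ (asymptoticVariance D V f) (U + s • Y) X := by
  obtain ⟨r, hr⟩ := exists_representsSource hsource
  exact (hasLineDerivAt_asymptoticVariance hV hf hW hsource hP hr (u := hX.toBCF) (w := hY.toBCF)
    hX.isSmooth.isFunction hY.isSmooth.isFunction s).lineDifferentiableAt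

include hP in
theorem IsPoissonSolution.hasLineDerivAt_lineDeriv (hφ : IsPoissonSolution D V f U φ g)
    {X Y : Space d → ℝ} (hX : D.IsTest X) (hY : D.IsTest Y) {ψ χ : Space d → ℝ}
    {k l : Space d → Space d}
    (hψ : IsWeakSolution D (V + U) (perturbedSource D V f U g (centre D V U X)) ψ k)
    (hχ : IsWeakSolution D (V + U) (perturbedSource D V f U g (centre D V U Y)) χ l) :
    HasLineDerivAt ℝ (fun U' => 1 / 2 * lineDeriv ℝ (asymptoticVariance D V f) U' X)
      (weightedTerm D V U g (centre D V U X) (centre D V U Y) -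
        gradientTerm D V U g (centre D V U X) (centre D V U Y) k l) U Y := by
  obtain ⟨r, hr⟩ := exists_representsSource hsource
  obtain ⟨γ, hγ⟩ := hφ.memH1Zero.exists_represents hW
  obtain ⟨κ, hκ⟩ := hψ.memH1Zero.exists_represents hW
  obtain ⟨η, hη⟩ := hχ.memH1Zero.exists_represents hW
  obtain rfl := (isWeakSolution_iff hW hr hφ.memH1Zero hγ).1 hφ
  have hκ_eq := (isWeakSolution_iff hW (hφ.representsSource_perturbedSource hV hf hW hsource hγ hX)
    hψ.memH1Zero hκ).1 hψ
  have hη_eq := (isWeakSolution_iff hW (hφ.representsSource_perturbedSource hV hf hW hsource hγ hY)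
    hχ.memH1Zero hη).1 hχ
  have hcentre {X : Space d → ℝ} (hX : D.IsTest X) :
      centre D V U X = ⇑(centreBCF D (V + U) hX.toBCF) := (coe_centreBCF D V U hX.toBCF).symm
  rw [hcentre hX, hcentre hY, weightedTerm_eq hW hγ, gradientTerm_eq hW hγ hκ hη hκ_eq hη_eq]
  convert! hasLineDerivAt_lineDeriv_asymptoticVariance hV hf hW hsource hP hr (u := hX.toBCF)
    (w := hY.toBCF) hX.isSmooth.isFunction hY.isSmooth.isFunction hη_eq using 1
  ring

end SecondVariation

/-! ### One-dimensional problems on the line -/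

theorem Space.inner_eq_mul (x y : Space 1) : inner ℝ x y = x 0 * y 0 := by
  simp [PiLp.inner_apply, mul_comm]

theorem exists_bounded_primitive {m : ℝ → ℝ} (hm : ContDiff ℝ ∞ m) (hs : HasCompactSupport m) :
    ∃ Q : ℝ → ℝ, ContDiff ℝ ∞ Q ∧ (∃ C, ∀ t, ‖Q t‖ ≤ C) ∧ ∀ t, HasDerivAt Q (m t) t := by
  have hQ (t : ℝ) : HasDerivAt (fun t => ∫ s in (0 : ℝ)..t, m s) (m t) t :=
    (hm.continuous.integral_hasStrictDerivAt 0 t).hasDerivAt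
  have hint : Integrable m := hm.continuous.integrable_of_hasCompactSupport hs
  refine ⟨fun t => ∫ s in (0 : ℝ)..t, m s, contDiff_infty_iff_deriv.2
    ⟨fun t => (hQ t).differentiableAt, ?_⟩, ⟨∫ s, ‖m s‖, fun t => ?_⟩, hQ⟩
  · rwa [deriv_eq hQ]
  · exact intervalIntegral.norm_integral_le_integral_norm_uIoc.trans
      (setIntegral_le_integral hint.norm (.of_forall fun s => norm_nonneg _))

theorem exists_bounded_gradient_eq {η : Space 1 → ℝ} (hη : ContDiff ℝ ∞ η)
    (hs : HasCompactSupport η) :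
    ∃ P : Space 1 → ℝ, ContDiff ℝ ∞ P ∧ (∃ C, ∀ x, ‖P x‖ ≤ C) ∧
      gradient P = fun x => η x • EuclideanSpace.single 0 1 := by
  let coord : Space 1 ≃L[ℝ] ℝ := PiLp.equivOfUnique 2 ℝ fun _ => ℝ
  obtain ⟨Q, hQ, ⟨C, hC⟩, hderiv⟩ := exists_bounded_primitive
    (hη.comp coord.symm.contDiff) (hs.comp_homeomorph coord.symm.toHomeomorph)
  refine ⟨Q ∘ coord, hQ.comp coord.contDiff, ⟨C, fun x => hC _⟩, funext fun x => ?_⟩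
  have hfderiv := (hderiv (coord x)).comp_hasFDerivAt x coord.hasFDerivAt
  refine ext_inner_right ℝ fun v => ?_
  rw [inner_gradient_left, hfderiv.fderiv, Space.inner_eq_mul, Function.comp_apply,
    coord.symm_apply_apply]
  simp [coord]

theorem IsPotential.memH1_of_bounded {D : Factor} {W u : Space d → ℝ} (hW : IsPotential D W)
    (hu : D.IsSmooth u) {C C' : ℝ} (hC : ∀ x, ‖u x‖ ≤ C) (hC' : ∀ x, ‖gradient u x‖ ≤ C') :
    MemH1 D W u (gradient u) := by
  have := hW.isProbabilityMeasure
  exact MemH1.of_isSmooth hu (.of_bound hu.continuous.aestronglyMeasurable C (.of_forall hC))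
    (.of_bound hu.continuous_gradient.aestronglyMeasurable C' (.of_forall hC'))

theorem exists_memH1_gradient_eq {η : Space 1 → ℝ} (hη : ContDiff ℝ ∞ η)
    (hs : HasCompactSupport η) :
    ∃ P : Space 1 → ℝ, Continuous P ∧ (∃ C, ∀ x, ‖P x‖ ≤ C) ∧
      ∀ W, IsPotential .line W → MemH1 .line W P (fun x => η x • EuclideanSpace.single 0 1) := by
  obtain ⟨P, hP, ⟨C, hC⟩, hgradient⟩ := exists_bounded_gradient_eq hη hs
  obtain ⟨C', hC'⟩ := hs.exists_bound_of_continuous hη.continuous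
  refine ⟨P, hP.continuous, ⟨C, hC⟩, fun W hW => ?_⟩
  rw [← hgradient]
  refine hW.memH1_of_bounded ⟨trivial, hP⟩ hC (C' := C') fun x => ?_
  rw [hgradient, norm_smul, PiLp.norm_single, norm_one, mul_one]
  exact hC' x

/-- The flux `g e^{-W}` of a vector field `g` on the line. For `g = ∇φ_U` and `W = V + U` it is
a primitive of `-(f - I) e^{-V}`. -/
def flux (W : Space 1 → ℝ) (g : Space 1 → Space 1) : Space 1 → ℝ :=
  fun x => g x 0 * Real.exp (-W x)

section Flux

variable {W : Space 1 → ℝ} {g : Space 1 → Space 1}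

theorem integrable_flux (hW : IsPotential .line W) (hg : MemLp g 2 (gibbs .line W)) :
    Integrable (flux W g) (Factor.line.leb 1) := by
  have := hW.isProbabilityMeasure
  have hint := (integrable_tilted_iff hW.integrable_exp _).1 (hg.integrable one_le_two)
  unfold flux
  simpa [mul_comm] using (EuclideanSpace.proj (𝕜 := ℝ) (0 : Fin 1)).integrable_comp hint

theorem integral_smul_flux (hW : IsPotential .line W) (g : Space 1 → Space 1) (η : Space 1 → ℝ) :
    ∫ x, η x • flux W g x ∂(Factor.line.leb 1) = partitionFunction .line W *
      ∫ x, inner ℝ (g x) (η x • EuclideanSpace.single 0 1) ∂(gibbs .line W) := by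
  rw [partitionFunction_mul_integral_gibbs hW.integrable_exp]
  refine integral_congr_ae (.of_forall fun x => ?_)
  simp only [flux, Space.inner_eq_mul, PiLp.smul_apply, PiLp.single_apply, if_true,
    smul_eq_mul]
  ring

theorem ae_eq_zero_of_orthogonal_gradients (hW : IsPotential .line W)
    (hg : MemLp g 2 (gibbs .line W))
    (horth : ∀ (v : Space 1 → ℝ) (k : Space 1 → Space 1), MemH1Zero .line W v k →
      ∫ x, inner ℝ (g x) (k x) ∂(gibbs .line W) = 0) : g =ᵐ[Factor.line.leb 1] 0 := by
  have hflux : ∀ᵐ x ∂(Factor.line.leb 1), flux W g x = 0 :=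
    ae_eq_zero_of_integral_contDiff_smul_eq_zero (integrable_flux hW hg).locallyIntegrable
      fun η hη hs => by
        obtain ⟨P, -, -, hP⟩ := exists_memH1_gradient_eq hη hs
        rw [integral_smul_flux hW, horth _ _ ((hP W hW).memH1Zero_sub_integral hW), mul_zero]
  filter_upwards [hflux] with x hx
  ext i
  rw [Subsingleton.elim i 0]
  exact (mul_eq_zero.1 hx).resolve_right (Real.exp_pos _).ne'

theorem sq_flux_mul_exp (x : Space 1) :
    flux W g x ^ 2 * Real.exp (W x) = ‖g x‖ ^ 2 * Real.exp (-W x) := by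
  rw [flux, ← real_inner_self_eq_norm_sq, Space.inner_eq_mul, Real.exp_neg]
  field_simp

theorem integrable_sq_flux_mul_exp (hW : IsPotential .line W) (hg : MemLp g 2 (gibbs .line W)) :
    Integrable (fun x => flux W g x ^ 2 * Real.exp (W x)) (Factor.line.leb 1) := by
  have hint := (integrable_tilted_iff hW.integrable_exp _).1 (integrable_inner_of_memLp_two hg hg)
  simpa only [sq_flux_mul_exp, real_inner_self_eq_norm_sq, smul_eq_mul, mul_comm] using hint

theorem partitionFunction_mul_energy (hW : IsPotential .line W) (g : Space 1 → Space 1) :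
    partitionFunction .line W * ∫ x, ‖g x‖ ^ 2 ∂(gibbs .line W) =
      ∫ x, flux W g x ^ 2 * Real.exp (W x) ∂(Factor.line.leb 1) := by
  simp_rw [partitionFunction_mul_integral_gibbs hW.integrable_exp, sq_flux_mul_exp]

end Flux

theorem gradientTerm_eq_zero {D : Factor} {U X : Space d → ℝ} {g k : Space d → Space d}
    (hk : k =ᵐ[D.leb d] fun x => X x • g x) (V Y : Space d → ℝ) (l : Space d → Space d) :
    gradientTerm D V U g X Y k l = 0 := by
  refine mul_eq_zero_of_right _ (integral_eq_zero_of_ae ?_)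
  filter_upwards [hk] with x hx
  rw [hx, sub_self, inner_zero_left, zero_mul, Pi.zero_apply]

section Line

variable {V f : Space 1 → ℝ} (hV : Integrable (fun x => Real.exp (-V x)) (Factor.line.leb 1))
  (hf : Integrable f (gibbs .line V))
include hV hf

theorem IsPoissonSolution.perturbed_gradient_ae_eq {U : Space 1 → ℝ}
    (hW : IsPotential .line (V + U))
    (hsource : MemLp (poissonSource .line V f U) 2 (gibbs .line (V + U)))
    {φ ψ : Space 1 → ℝ} {g k : Space 1 → Space 1} (hφ : IsPoissonSolution .line V f U φ g)
    {X : Space 1 → ℝ} (hX : Factor.line.IsTest X)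
    (hψ : IsWeakSolution .line (V + U)
      (perturbedSource .line V f U g (centre .line V U X)) ψ k) :
    k =ᵐ[Factor.line.leb 1] fun x => centre .line V U X x • g x := by
  have hk := hψ.memH1Zero.memH1.memLp_grad
  have hXg : MemLp (centre .line V U X • g) 2 (gibbs .line (V + U)) :=
    hφ.memH1Zero.memH1.memLp_grad.smul (hX.memLp_top_centre V U)
  have hdiff : k - centre .line V U X • g =ᵐ[Factor.line.leb 1] 0 := by
    refine ae_eq_zero_of_orthogonal_gradients hW (hk.sub hXg) fun v m hv => ?_
    have hm := hv.memH1.memLp_grad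
    have hkm := (hψ.weak_formulation v m hv).trans
      (hφ.integral_perturbedSource_centre_mul hV hf hW hsource hX hv.memH1)
    simp only [Pi.sub_apply, inner_sub_left]
    rw [integral_sub (integrable_inner_of_memLp_two hk hm) (integrable_inner_of_memLp_two hXg hm),
      hkm]
    simp only [Pi.smul_apply', real_inner_smul_left, sub_self]
  filter_upwards [hdiff] with x hx
  exact sub_eq_zero.1 hx

theorem IsPoissonSolution.integral_gradient_mul_flux {U φ : Space 1 → ℝ} {g : Space 1 → Space 1}
    (hW : IsPotential .line (V + U)) (hφ : IsPoissonSolution .line V f U φ g) {P η : Space 1 → ℝ}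
    (hP : MemH1 .line (V + U) P (fun x => η x • EuclideanSpace.single 0 1))
    (hcont : Continuous P) {C : ℝ} (hC : ∀ x, ‖P x‖ ≤ C) :
    ∫ x, η x • flux (V + U) g x ∂(Factor.line.leb 1) =
      ∫ x, centredObservable .line V f x * P x * Real.exp (-V x) ∂(Factor.line.leb 1) := by
  have hint_density : Integrable
      (fun x => centredObservable .line V f x * P x * Real.exp (-V x)) (Factor.line.leb 1) := by
    refine Integrable.congr ?_ (.of_forall fun x => mul_right_comm _ _ _)
    exact (integrable_centredObservable_mul_exp hV hf).mul_bdd hcont.aestronglyMeasurable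
      (.of_forall hC)
  have hint : Integrable (fun x => poissonSource .line V f U x * P x) (gibbs .line (V + U)) :=
    (integrable_tilted_iff hW.integrable_exp _).2
      (by simpa only [exp_smul_poissonSource_mul] using hint_density)
  rw [integral_smul_flux hW, hφ.weak_formulation _ _ (hP.memH1Zero_sub_integral hW),
    mul_integral_poissonSource_sub_const hV hf hW.integrable_exp hW.integrable_exp hint,
    mul_integral_poissonSource_mul hW.integrable_exp]

theorem IsPoissonSolution.flux_ae_eq {U U' φ φ' : Space 1 → ℝ} {g g' : Space 1 → Space 1}
    (hW : IsPotential .line (V + U)) (hW' : IsPotential .line (V + U'))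
    (hφ : IsPoissonSolution .line V f U φ g) (hφ' : IsPoissonSolution .line V f U' φ' g') :
    flux (V + U) g =ᵐ[Factor.line.leb 1] flux (V + U') g' := by
  refine ae_eq_of_integral_contDiff_smul_eq
    (integrable_flux hW hφ.memH1Zero.memH1.memLp_grad).locallyIntegrable
    (integrable_flux hW' hφ'.memH1Zero.memH1.memLp_grad).locallyIntegrable fun η hη hs => ?_
  obtain ⟨P, hcont, ⟨C, hC⟩, hP⟩ := exists_memH1_gradient_eq hη hs
  rw [hφ.integral_gradient_mul_flux hV hf hW (hP _ hW) hcont hC,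
    hφ'.integral_gradient_mul_flux hV hf hW' (hP _ hW') hcont hC]

theorem asymptoticVariance_eq_integral_flux {U U' φ φ' : Space 1 → ℝ} {g g' : Space 1 → Space 1}
    (hW : IsPotential .line (V + U)) (hW' : IsPotential .line (V + U'))
    (hφ : IsPoissonSolution .line V f U φ g) (hφ' : IsPoissonSolution .line V f U' φ' g') :
    Integrable (fun x => flux (V + U) g x ^ 2 * Real.exp ((V + U') x)) (Factor.line.leb 1) ∧
      asymptoticVariance .line V f U' = 2 / partitionFunction .line V ^ 2 *
        ((∫ x, Real.exp (-(V + U') x) ∂(Factor.line.leb 1)) *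
          ∫ x, flux (V + U) g x ^ 2 * Real.exp ((V + U') x) ∂(Factor.line.leb 1)) := by
  have hex : ∃ p : (Space 1 → ℝ) × (Space 1 → Space 1),
      IsPoissonSolution .line V f U' p.1 p.2 := ⟨(φ', g'), hφ'⟩
  have hdensity : (fun x => flux (V + U') hex.choose.2 x ^ 2 * Real.exp ((V + U') x))
      =ᵐ[Factor.line.leb 1] fun x => flux (V + U) g x ^ 2 * Real.exp ((V + U') x) := by
    filter_upwards [hφ.flux_ae_eq hV hf hW hW' hex.choose_spec] with x hx
    rw [hx]
  refine ⟨(integrable_sq_flux_mul_exp hW'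
    hex.choose_spec.memH1Zero.memH1.memLp_grad).congr hdensity, ?_⟩
  rw [asymptoticVariance, dif_pos hex, ← integral_congr_ae hdensity,
    ← partitionFunction_mul_energy hW', partitionFunction]
  ring

end Line

section Convexity

variable {α : Type*} [MeasurableSpace α] {ν : Measure α} {G : α → ℝ}

theorem exp_add_le_add_mul_exp {a b : ℝ} (ha : 0 ≤ a) (hb : 0 ≤ b) (hab : a + b = 1) (s t : ℝ) :
    Real.exp (a * s + b * t) ≤ a * Real.exp s + b * Real.exp t :=
  convexOn_exp.2 (Set.mem_univ s) (Set.mem_univ t) ha hb hab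

theorem convex_setOf_integrable_mul_exp (hG : ∀ x, 0 ≤ G x) (hG_meas : AEMeasurable G ν) :
    Convex ℝ {W : α → ℝ | AEMeasurable W ν ∧ Integrable (fun x => G x * Real.exp (W x)) ν} := by
  rintro W₀ ⟨hm₀, hi₀⟩ W₁ ⟨hm₁, hi₁⟩ a b ha hb hab
  have hm : AEMeasurable (a • W₀ + b • W₁) ν := (hm₀.const_smul a).add (hm₁.const_smul b)
  refine ⟨hm, ((hi₀.const_mul a).add (hi₁.const_mul b)).mono'
    (hG_meas.mul hm.exp).aestronglyMeasurable (.of_forall fun x => ?_)⟩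
  rw [Real.norm_of_nonneg (mul_nonneg (hG x) (Real.exp_pos _).le)]
  have hexp := mul_le_mul_of_nonneg_left (exp_add_le_add_mul_exp ha hb hab (W₀ x) (W₁ x)) (hG x)
  simp only [Pi.add_apply, Pi.smul_apply, smul_eq_mul]
  linarith

theorem convex_setOf_integrable_exp_neg :
    Convex ℝ {W : α → ℝ | AEMeasurable W ν ∧ Integrable (fun x => Real.exp (-W x)) ν} := by
  have hconvex := (convex_setOf_integrable_mul_exp (ν := ν) (G := fun _ => 1) (fun _ => zero_le_one)
    aemeasurable_const).neg
  simpa only [Set.neg_ofPred, Pi.neg_def, aemeasurable_neg_iff, one_mul] using hconvex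

theorem IsPotential.aemeasurable {D : Factor} {W : Space d → ℝ} (hW : IsPotential D W)
    (m : Measure (Space d)) : AEMeasurable W m :=
  hW.continuous.measurable.aemeasurable

theorem convex_setOf_isPotential (D : Factor) : Convex ℝ {W : Space d → ℝ | IsPotential D W} := by
  intro W₀ h₀ W₁ h₁ a b ha hb hab
  exact ⟨h₀.isFunction.comp₂ h₁.isFunction fun s t => a • s + b • t,
    (h₀.continuous.const_smul a).add (h₁.continuous.const_smul b),
    (convex_setOf_integrable_exp_neg ⟨h₀.aemeasurable _, h₀.integrable_exp⟩
      ⟨h₁.aemeasurable _, h₁.integrable_exp⟩ ha hb hab).2⟩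

theorem convexOn_integral_exp_neg_mul_integral_mul_exp [SFinite ν] (hG : ∀ x, 0 ≤ G x)
    (hG_meas : AEMeasurable G ν) :
    ConvexOn ℝ
      ({W | AEMeasurable W ν ∧ Integrable (fun x => Real.exp (-W x)) ν} ∩
        {W | AEMeasurable W ν ∧ Integrable (fun x => G x * Real.exp (W x)) ν})
      fun W => (∫ x, Real.exp (-W x) ∂ν) * ∫ x, G x * Real.exp (W x) ∂ν := by
  have hconvex := (convex_setOf_integrable_exp_neg (ν := ν)).inter
    (convex_setOf_integrable_mul_exp hG hG_meas)
  refine ⟨hconvex, fun W₀ h₀ W₁ h₁ a b ha hb hab => ?_⟩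
  have hprod {W : α → ℝ} (h : W ∈
      {W | AEMeasurable W ν ∧ Integrable (fun x => Real.exp (-W x)) ν} ∩
        {W | AEMeasurable W ν ∧ Integrable (fun x => G x * Real.exp (W x)) ν}) :
      Integrable (fun z : α × α => Real.exp (-W z.1) * (G z.2 * Real.exp (W z.2))) (ν.prod ν) :=
    h.1.2.mul_prod h.2.2
  have hexp (s t y : ℝ) : Real.exp (-s) * (y * Real.exp t) = y * Real.exp (t - s) := by
    rw [sub_eq_neg_add, Real.exp_add]
    ring
  simp only [smul_eq_mul]
  rw [← integral_prod_mul, ← integral_prod_mul, ← integral_prod_mul, ← integral_const_mul,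
    ← integral_const_mul, ← integral_add ((hprod h₀).const_mul a) ((hprod h₁).const_mul b)]
  refine integral_mono (hprod (hconvex h₀ h₁ ha hb hab))
    (((hprod h₀).const_mul a).add ((hprod h₁).const_mul b)) fun z => ?_
  have hle := mul_le_mul_of_nonneg_left
    (exp_add_le_add_mul_exp ha hb hab (W₀ z.2 - W₀ z.1) (W₁ z.2 - W₁ z.1)) (hG z.2)
  have hsplit : a * W₀ z.2 + b * W₁ z.2 - (a * W₀ z.1 + b * W₁ z.1) =
      a * (W₀ z.2 - W₀ z.1) + b * (W₁ z.2 - W₁ z.1) := by ring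
  simp only [hexp, Pi.add_apply, Pi.smul_apply, smul_eq_mul, hsplit]
  linarith

end Convexity

theorem asymptoticVariance_nonneg (D : Factor) (V f U : Space d → ℝ) :
    0 ≤ asymptoticVariance D V f U := by
  unfold asymptoticVariance
  split_ifs
  · exact mul_nonneg (by positivity) (integral_nonneg fun x => by positivity)
  · exact le_rfl

theorem asymptoticVariance_convex_combination {V f : Space 1 → ℝ}
    (hV : Integrable (fun x => Real.exp (-V x)) (Factor.line.leb 1))
    (hf : Integrable f (gibbs .line V)) {U₀ U₁ φ₀ φ₁ : Space 1 → ℝ} {g₀ g₁ : Space 1 → Space 1}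
    (hW₀ : IsPotential .line (V + U₀)) (hW₁ : IsPotential .line (V + U₁))
    (hφ₀ : IsPoissonSolution .line V f U₀ φ₀ g₀) (hφ₁ : IsPoissonSolution .line V f U₁ φ₁ g₁)
    {a b : ℝ} (ha : 0 ≤ a) (hb : 0 ≤ b) (hab : a + b = 1) :
    asymptoticVariance .line V f (a • U₀ + b • U₁) ≤
      a * asymptoticVariance .line V f U₀ + b * asymptoticVariance .line V f U₁ := by
  by_cases hex : ∃ p : (Space 1 → ℝ) × (Space 1 → Space 1),
      IsPoissonSolution .line V f (a • U₀ + b • U₁) p.1 p.2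
  · obtain ⟨⟨φ, g⟩, hφ⟩ := hex
    have hcomb : V + (a • U₀ + b • U₁) = a • (V + U₀) + b • (V + U₁) := by
      rw [smul_add, smul_add, add_add_add_comm, ← add_smul, hab, one_smul]
    have hW : IsPotential .line (V + (a • U₀ + b • U₁)) :=
      hcomb ▸ convex_setOf_isPotential .line hW₀ hW₁ ha hb hab
    have hflux := integrable_flux hW₀ hφ₀.memH1Zero.memH1.memLp_grad
    have hvariance {U φ g} (hW : IsPotential .line (V + U))
        (hφ : IsPoissonSolution .line V f U φ g) :=
      asymptoticVariance_eq_integral_flux hV hf hW₀ hW hφ₀ hφ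
    have hconvex := (convexOn_integral_exp_neg_mul_integral_mul_exp (fun x => sq_nonneg _)
      (hflux.aemeasurable.pow_const 2)).2
      ⟨⟨hW₀.aemeasurable _, hW₀.integrable_exp⟩, hW₀.aemeasurable _, (hvariance hW₀ hφ₀).1⟩
      ⟨⟨hW₁.aemeasurable _, hW₁.integrable_exp⟩, hW₁.aemeasurable _, (hvariance hW₁ hφ₁).1⟩
      ha hb hab
    rw [← hcomb] at hconvex
    rw [(hvariance hW hφ).2, (hvariance hW₀ hφ₀).2, (hvariance hW₁ hφ₁).2]
    refine (mul_le_mul_of_nonneg_left hconvex (by positivity)).trans_eq ?_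
    simp only [smul_eq_mul]
    ring
  · rw [asymptoticVariance, dif_neg hex]
    exact add_nonneg (mul_nonneg ha (asymptoticVariance_nonneg ..))
      (mul_nonneg hb (asymptoticVariance_nonneg ..))

theorem IsAdmissible.isPotential {D : Factor} {V f U : Space d → ℝ} (hVf : IsTargetPair D V f)
    (hU : IsAdmissible D V f U) : IsPotential D (V + U) :=
  ⟨hVf.smooth_potential.isFunction.comp₂ hU.smooth.isFunction (· + ·),
    hVf.smooth_potential.contDiff.continuous.add hU.smooth.contDiff.continuous, hU.integrable_exp⟩

theorem mainTheorem5_general (D : Factor) (V f : Space d → ℝ)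
    (hV : Integrable (fun x => Real.exp (-V x)) (D.leb d)) (hf : Integrable f (gibbs D V)) :
    (∀ U : Space d → ℝ, IsPotential D (V + U) → Poincare D (V + U) →
      MemLp (poissonSource D V f U) 2 (gibbs D (V + U)) →
      WellPosed D (V + U) (poissonSource D V f U) ∧
      ∀ (φ : Space d → ℝ) (gφ : Space d → Space d), IsPoissonSolution D V f U φ gφ →
        (∀ δX : Space d → ℝ, D.IsTest δX →
          WellPosed D (V + U) (perturbedSource D V f U gφ (centre D V U δX))) ∧
        ∀ δU δW : Space d → ℝ, D.IsTest δU → D.IsTest δW →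
          (∀ ε : ℝ, LineDifferentiableAt ℝ (asymptoticVariance D V f) (U + ε • δW) δU) ∧
          ∀ (ψU ψW : Space d → ℝ) (gU gW : Space d → Space d),
            IsWeakSolution D (V + U)
              (perturbedSource D V f U gφ (centre D V U δU)) ψU gU →
            IsWeakSolution D (V + U)
              (perturbedSource D V f U gφ (centre D V U δW)) ψW gW →
            HasLineDerivAt ℝ
              (fun U' : Space d → ℝ => 1 / 2 * lineDeriv ℝ (asymptoticVariance D V f) U' δU)
              (weightedTerm D V U gφ (centre D V U δU) (centre D V U δW) -
                gradientTerm D V U gφ (centre D V U δU) (centre D V U δW) gU gW) U δW ∧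
            (D = Factor.line → d = 1 →
              gradientTerm D V U gφ (centre D V U δU) (centre D V U δW) gU gW = 0)) ∧
    (D = Factor.line → d = 1 →
      ∀ U₀ U₁ : Space d → ℝ, IsPotential D (V + U₀) → IsPotential D (V + U₁) →
        (∃ φ₀ g₀, IsPoissonSolution D V f U₀ φ₀ g₀) →
        (∃ φ₁ g₁, IsPoissonSolution D V f U₁ φ₁ g₁) →
        ∀ t : ℝ, 0 ≤ t → t ≤ 1 →
          asymptoticVariance D V f ((1 - t) • U₀ + t • U₁) ≤
            (1 - t) * asymptoticVariance D V f U₀ + t * asymptoticVariance D V f U₁) := by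
  refine ⟨fun U hW hP hsource => ⟨wellPosed_poissonSource hW hP hsource, fun φ gφ hφ =>
    ⟨fun δX => hφ.wellPosed_perturbedSource hV hf hW hsource hP, fun δU δW hδU hδW =>
      ⟨lineDifferentiableAt_asymptoticVariance hV hf hW hsource hP hδU hδW, ?_⟩⟩⟩, ?_⟩
  · intro ψU ψW gU gW hψU hψW
    refine ⟨hφ.hasLineDerivAt_lineDeriv hV hf hW hsource hP hδU hδW hψU hψW, ?_⟩
    rintro rfl rfl
    exact gradientTerm_eq_zero (hφ.perturbed_gradient_ae_eq hV hf hW hsource hδU hψU) V _ _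
  · rintro rfl rfl U₀ U₁ hW₀ hW₁ ⟨φ₀, g₀, hφ₀⟩ ⟨φ₁, g₁, hφ₁⟩ t ht₀ ht₁
    exact asymptoticVariance_convex_combination hV hf hW₀ hW₁ hφ₀ hφ₁ (sub_nonneg.2 ht₁) ht₀
      (sub_add_cancel 1 t)

end

theorem mainTheorem5 {d : ℕ} (D : Factor) (V f : Space d → ℝ) (hVf : IsTargetPair D V f) :
    (∀ U : Space d → ℝ, IsAdmissible D V f U →
      WellPosed D (V + U) (poissonSource D V f U) ∧
      ∀ (φ : Space d → ℝ) (gφ : Space d → Space d), IsPoissonSolution D V f U φ gφ →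
        (∀ δX : Space d → ℝ, D.IsTest δX →
          WellPosed D (V + U) (perturbedSource D V f U gφ (centre D V U δX))) ∧
        ∀ δU δW : Space d → ℝ, D.IsTest δU → D.IsTest δW →
          (∀ ε : ℝ, LineDifferentiableAt ℝ (asymptoticVariance D V f) (U + ε • δW) δU) ∧
          ∀ (ψU ψW : Space d → ℝ) (gU gW : Space d → Space d),
            IsWeakSolution D (V + U)
              (perturbedSource D V f U gφ (centre D V U δU)) ψU gU →
            IsWeakSolution D (V + U)
              (perturbedSource D V f U gφ (centre D V U δW)) ψW gW →
            HasLineDerivAt ℝ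
              (fun U' : Space d → ℝ => 1 / 2 * lineDeriv ℝ (asymptoticVariance D V f) U' δU)
              (weightedTerm D V U gφ (centre D V U δU) (centre D V U δW) -
                gradientTerm D V U gφ (centre D V U δU) (centre D V U δW) gU gW) U δW ∧
            (D = Factor.line → d = 1 →
              gradientTerm D V U gφ (centre D V U δU) (centre D V U δW) gU gW = 0)) ∧
    (D = Factor.line → d = 1 →
      ∀ U₀ U₁ : Space d → ℝ, IsAdmissible D V f U₀ → IsAdmissible D V f U₁ →
        ∀ t : ℝ, 0 ≤ t → t ≤ 1 →
          asymptoticVariance D V f ((1 - t) • U₀ + t • U₁) ≤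
            (1 - t) * asymptoticVariance D V f U₀ + t * asymptoticVariance D V f U₁) := by
  obtain ⟨hvariation, hconvex⟩ :=
    mainTheorem5_general D V f hVf.integrable_exp hVf.integrable_observable
  have hadmissible {U : Space d → ℝ} (hU : IsAdmissible D V f U) :=
    hvariation U (hU.isPotential hVf) hU.poincare hU.memLp_source
  exact ⟨fun U => hadmissible, fun hD hd U₀ U₁ hU₀ hU₁ => hconvex hD hd U₀ U₁ (hU₀.isPotential hVf)
    (hU₁.isPotential hVf) (hadmissible hU₀).1.1 (hadmissible hU₁).1.1⟩
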